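/- Let $d\ge 1$, let $u:\mathbb R^d\to\mathbb R$ be differentiable, $h=\nabla u$, and suppose there are $m,L,l>0$ such that for all $x,y\in\mathbb R^d$ $$\langle h(x)-h(y),x-y\rangle\ge 2m|x-y|^2,\qquad |h(x)-h(y)|\le L(1+|x|+|y|)^l|x-y|.$$ For $\lambda>0$ put $g(x)=h(x)-mx$, $r=(L+m)\,(1/\sqrt\lambda)^{1/(l+2)}$, $R=\sup_{|x|<r}|g(x)|$, and define the tamed drift $$h_\lambda(x)=t(x)g(x)+R\,s(x)\,x+mx,$$ where $t(x)=1$ if $|x|\le r-1$, $t(x)=r-|x|$ if $r-1<|x|<r$, $t(x)=0$ if $|x|\ge r$; and $s(x)=0$ if $|x|\le r-2$, $s(x)=|x|-r+2$ if $r-2<|x|<r-1$, $s(x)=1$ if $r-1\le|x|\le r$ (in the cases not covered before), $s(x)=r/|x|$ if $|x|>r$. Let $\gamma>0$ and $\eta=e^{-\lambda\gamma/2}$. Let $P$ be the OBABO Markov kernel on $\mathbb R^{2d}$: $P((x_0,v_0),\cdot)$ is the law of $(x_1,v_1)$, where $$x_1=x_0+\lambda\big(\eta v_0+\sqrt{1-\eta^2}\,G\big)-\tfrac{\lambda^2}{2}h_\lambda(x_0),\qquad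 v_1=\eta^2v_0-\tfrac{\lambda\eta}{2}\big(h_\lambda(x_0)+h_\lambda(x_1)\big)+\sqrt{1-\eta^2}\,(\eta G+G')$$ with $G,G'$ independent standard Gaussian vectors in $\mathbb R^d$. Let $M_\lambda$ be the (smallest) Lipschitz constant of $h_\lambda$, or any larger real number. Assume $\gamma\ge 2\sqrt{M_\lambda}$ and $\lambda\le m/(33\gamma^3)$, and set $a=1/M_\lambda$, $b=1/\gamma$, $\kappa=m/(3\gamma)$. For $p\ge1$, $\mathcal P_p(\mathbb R^{2d})$ is the set of Borel probability measures with finite $p$-th moment, $\mathcal W_p$ is the $p$-Wasserstein distance for the Euclidean norm of $\mathbb R^{2d}$, and $\mathcal W_{p,a,b}$ is the one for the norm $|(x,v)|_{a,b}=(|x|^2+2b\langle x,v\rangle+a|v|^2)^{1/2}$. Then for all $p\ge 1$ and all $\nu,\mu\in\mathcal P_p(\mathbb R^{2d})$, $$\mathcal W_{p,a,b}^2(\nu P,\mu P)\le(1-\lambda\kappa)\,\mathcal W_{p,a,b}^2(\nu,\mu),$$ and, if $M_\lambda\ge1$, for all $n\in\mathbb N$, $$\mathcal W_p^2(\nu P^n,\mu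 P^n)\le 3M_\lambda(1-\lambda\kappa)^n\,\mathcal W_p^2(\nu,\mu).$$ Moreover, $P$ has an invariant probability measure $\Pi_\lambda$; it is the only one among all probability measures on $\mathbb R^{2d}$, and $\Pi_\lambda\in\mathcal P_p(\mathbb R^{2d})$ for all $p\ge1$. -/

import Mathlib

open MeasureTheory ProbabilityTheory
open scoped ENNReal NNReal

noncomputable section

namespace TamedOBABO

/-- The position (and velocity) space `ℝᵈ` with its Euclidean norm. -/
abbrev E (d : ℕ) : Type := EuclideanSpace ℝ (Fin d)

/-- The phase space `ℝ²ᵈ`, written as pairs `z = (x, v)`. The default norm of a product type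
(the maximum) is never used: all norms on it are given explicitly by `weightedNorm`. -/
abbrev Phase (d : ℕ) : Type := E d × E d

/-- Strong convexity: `⟨h x - h y, x - y⟩ ≥ 2 m |x - y|²`. -/
def StrongMonotone {d : ℕ} (h : E d → E d) (m : ℝ) : Prop :=
  ∀ x y : E d, 2 * m * ‖x - y‖ ^ 2 ≤ inner ℝ (h x - h y) (x - y)

/-- Local Lipschitz continuity with polynomial growth:
`|h x - h y| ≤ L (1 + |x| + |y|)ˡ |x - y|`. -/
def PolyLipschitz {d : ℕ} (h : E d → E d) (L l : ℝ) : Prop :=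
  ∀ x y : E d, ‖h x - h y‖ ≤ L * (1 + ‖x‖ + ‖y‖) ^ l * ‖x - y‖

section Taming

variable {d : ℕ}

/-- `g(x) = h(x) - m x`. -/
def gDrift (h : E d → E d) (m : ℝ) (x : E d) : E d := h x - m • x

/-- The taming radius `r = (L + m) (1 / √lam) ^ (1 / (l + 2))`. -/
def tamingRadius (m L l lam : ℝ) : ℝ := (L + m) * (1 / √lam) ^ (1 / (l + 2))

/-- `R = sup_{B(0,r)} |g|`. -/
def tamingSup (h : E d → E d) (m r : ℝ) : ℝ :=
  sSup ((fun x : E d => ‖gDrift h m x‖) '' Metric.ball 0 r)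

/-- The cut-off `t`, as a function of `ρ = |x|`. -/
def cutT (r ρ : ℝ) : ℝ :=
  if ρ ≤ r - 1 then 1 else if ρ < r then r - ρ else 0

/-- The cut-off `s`, as a function of `ρ = |x|`. -/
def cutS (r ρ : ℝ) : ℝ :=
  if ρ ≤ r - 2 then 0 else if ρ < r - 1 then ρ - r + 2 else if ρ ≤ r then 1 else r / ρ

/-- The tamed drift `h_lam(x) = t(x) g(x) + R s(x) x + m x`. -/
def tamedDrift (h : E d → E d) (m L l lam : ℝ) (x : E d) : E d :=
  let r := tamingRadius m L l lam
  cutT r ‖x‖ • gDrift h m x + (tamingSup h m r * cutS r ‖x‖) • x + m • x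

/-- The Lipschitz constant of a map, i.e. its smallest one. -/
def lipConst (f : E d → E d) : ℝ≥0 := sInf {K : ℝ≥0 | LipschitzWith K f}

end Taming

section Scheme

variable {d : ℕ}

/-- The damping factor `η = exp (- lam γ / 2)` of each half O-step. -/
def eta (lam γ : ℝ) : ℝ := Real.exp (-(lam * γ) / 2)

/-- The new position of one OBABO step with drift `b` from `(x, v)`, with Gaussian input `G`. -/
def obaboPos (b : E d → E d) (lam γ : ℝ) (x v G : E d) : E d :=
  x + lam • (eta lam γ • v + √(1 - eta lam γ ^ 2) • G) - (lam ^ 2 / 2) • b x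

/-- One OBABO step with drift `b` from `(x, v)`, with Gaussian inputs `G`, `G'`;
the argument is `((x, v), (G, G'))`. -/
def obaboStep (b : E d → E d) (lam γ : ℝ) (w : Phase d × (E d × E d)) : Phase d :=
  let x := w.1.1
  let v := w.1.2
  let G := w.2.1
  let G' := w.2.2
  let x₁ := obaboPos b lam γ x v G
  (x₁, eta lam γ ^ 2 • v - (lam * eta lam γ / 2) • (b x + b x₁)
        + √(1 - eta lam γ ^ 2) • (eta lam γ • G + G'))

/-- The OBABO step written as the five substeps O, B, A, B, O. -/
theorem obaboStep_eq_substeps (b : E d → E d) (lam γ : ℝ) (x v G G' : E d) :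
    obaboStep b lam γ ((x, v), (G, G')) =
      (let v₀ := eta lam γ • v + √(1 - eta lam γ ^ 2) • G
       let vh := v₀ - (lam / 2) • b x
       let x₁ := x + lam • vh
       let v' := vh - (lam / 2) • b x₁
       (x₁, eta lam γ • v' + √(1 - eta lam γ ^ 2) • G')) := by
  have hx : obaboPos b lam γ x v G =
      x + lam • (eta lam γ • v + √(1 - eta lam γ ^ 2) • G - (lam / 2) • b x) := by
    unfold obaboPos
    module
  simp only [obaboStep, hx]
  refine Prod.ext rfl ?_
  simp only
  module

/-- The Markov kernel `P` of the OBABO chain: `P(z, ·)` is the law of the step from `z` with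
independent standard Gaussian inputs (see `obaboKernel_apply`). -/
def obaboKernel (b : E d → E d) (lam γ : ℝ) : Kernel (Phase d) (Phase d) :=
  (Kernel.id ×ₖ Kernel.const (Phase d) ((stdGaussian (E d)).prod (stdGaussian (E d)))).map
    (obaboStep b lam γ)

theorem measurable_obaboStep {b : E d → E d} (hb : Measurable b) (lam γ : ℝ) :
    Measurable (obaboStep b lam γ) := by
  unfold obaboStep obaboPos
  fun_prop

theorem obaboKernel_apply {b : E d → E d} (hb : Measurable b) (lam γ : ℝ) (z : Phase d) :
    obaboKernel b lam γ z =
      ((stdGaussian (E d)).prod (stdGaussian (E d))).map (fun G => obaboStep b lam γ (z, G)) := by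
  have hs := measurable_obaboStep hb lam γ
  rw [obaboKernel, Kernel.map_apply _ hs, Kernel.prod_apply, Kernel.id_apply, Kernel.const_apply,
    Measure.dirac_prod, Measure.map_map hs (by fun_prop)]
  rfl

/-- The law `ν Pⁿ`. -/
def lawAfter (P : Kernel (Phase d) (Phase d)) (n : ℕ) (ν : Measure (Phase d)) :
    Measure (Phase d) :=
  (fun ρ : Measure (Phase d) => ρ.bind P)^[n] ν

end Scheme

section Wasserstein

variable {d : ℕ}

/-- The weighted norm `|z|_{a,b} = (|x|² + 2 b ⟨x, v⟩ + a |v|²)^{1/2}` of `z = (x, v)`. -/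
def weightedNorm (a b : ℝ) (z : Phase d) : ℝ :=
  √(‖z.1‖ ^ 2 + 2 * b * inner ℝ z.1 z.2 + a * ‖z.2‖ ^ 2)

/-- The Euclidean norm of `ℝ²ᵈ`. -/
def euclNorm (z : Phase d) : ℝ := √(‖z.1‖ ^ 2 + ‖z.2‖ ^ 2)

/-- The set `𝒫_p(ℝ²ᵈ)` of probability measures with finite `p`-th moment. -/
def InPp (p : ℝ) (μ : Measure (Phase d)) : Prop :=
  IsProbabilityMeasure μ ∧ ∫⁻ z, ENNReal.ofReal (euclNorm z) ^ p ∂μ < ⊤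

/-- The couplings of `μ` and `ν`. -/
def couplings (μ ν : Measure (Phase d)) : Set (Measure (Phase d × Phase d)) :=
  {ρ | ρ.map Prod.fst = μ ∧ ρ.map Prod.snd = ν}

/-- The `p`-Wasserstein distance for the norm `N`:
`(inf_ρ ∫ N(z - z')ᵖ dρ(z, z'))^{1/p}` over the couplings `ρ` of `μ` and `ν`. -/
def wass (N : Phase d → ℝ) (p : ℝ) (μ ν : Measure (Phase d)) : ℝ≥0∞ :=
  (⨅ ρ ∈ couplings μ ν, ∫⁻ w, ENNReal.ofReal (N (w.1 - w.2)) ^ p ∂ρ) ^ (1 / p)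

end Wasserstein

end TamedOBABO

end

open TamedOBABO

/-! Two chains driven by the same Gaussian inputs have noise-free differences, so the contraction
reduces to one deterministic inequality for a pair of phase points. Since `h_λ` is not a gradient in
general, what replaces convexity is cocoercivity of `f = h_λ - m`: `|f x - f y|² ≤ 3 (M - m) ⟨f x -
f y, x - y⟩` (`tamedDriftAt_cocoercive`).

For `|x| ≤ |y|` the increment of `f` splits into `t(|y|) (g x - g y)` and a radial part `R s(|x|) x
- R s(|y|) y + (t(|x|) - t(|y|)) g x`. The radial part is cocoercive with constant `2 (M - m)`
(`radial_cocoercive`): `t` varies only where `s = 1`, and there `R s x` compensates the loss of `t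
g`. Hence it is monotone, so the Lipschitz bound `M` of `h_λ` passes to `t(σ) g` on the ball of
radius `σ`. As `g` is the gradient of a convex function, a Baillon-Haddad argument confined to that
ball (`gradient_cocoercive_on_ball`) makes the first part cocoercive with constant `M - m`. The two
constants add up to `3 (M - m)`.

In units with `γ = 1` (`obabo_contraction_normalized`), the twist `b = 1/γ` cancels the
position-velocity term to first order in the step and produces the dissipation `⟨f x - f y, x - y⟩`
at both ends of the step. By cocoercivity this absorbs the force-velocity cross terms at a cost of
3/2 of the squared velocity, weighted by `a`, out of the 2 supplied by friction. The condition `γ ≥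
2 √M` pays for the rest, and `m` leaves the rate `κ`.

Pushing a coupling forward with common noise gives the Wasserstein bounds. For the invariant law,
the iterates from the origin have bounded moments, hence are tight, and a limit point is invariant
because the laws from any two starting laws merge when tested on bounded Lipschitz functions. This
merging needs no moments, so uniqueness holds among all probability measures. -/

namespace TamedOBABO

/-! ### Scalar properties of the cut-offs -/

section Cutoff

theorem cutT_nonneg {r ρ : ℝ} : 0 ≤ cutT r ρ := by
  unfold cutT; split_ifs <;> linarith

theorem cutT_le_one {r ρ : ℝ} : cutT r ρ ≤ 1 := by
  unfold cutT; split_ifs <;> linarith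

theorem cutT_eq_zero {r ρ : ℝ} (h : r ≤ ρ) : cutT r ρ = 0 := by
  unfold cutT; split_ifs <;> linarith

theorem cutT_antitone {r ρ σ : ℝ} (h : ρ ≤ σ) : cutT r σ ≤ cutT r ρ := by
  unfold cutT; split_ifs <;> linarith

theorem cutT_sub_le {r ρ σ : ℝ} (h : ρ ≤ σ) : cutT r ρ - cutT r σ ≤ σ - ρ := by
  unfold cutT; split_ifs <;> linarith

theorem cutS_nonneg {r ρ : ℝ} (hr : 0 < r) : 0 ≤ cutS r ρ := by
  unfold cutS
  split_ifs with h1 h2 h3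
  · linarith
  · linarith
  · linarith
  · have : 0 < ρ := by linarith
    positivity

theorem cutS_le_one {r ρ : ℝ} (hr : 0 < r) : cutS r ρ ≤ 1 := by
  unfold cutS
  split_ifs with h1 h2 h3
  · linarith
  · linarith
  · linarith
  · rw [div_le_one (by linarith)]; linarith

theorem cutS_of_shell {r ρ : ℝ} (h1 : r - 1 ≤ ρ) (h2 : ρ ≤ r) : cutS r ρ = 1 := by
  unfold cutS; split_ifs <;> linarith

theorem cutS_mul_of_ge {r ρ : ℝ} (hr : 0 < r) (h : r ≤ ρ) : cutS r ρ * ρ = r := by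
  rcases h.eq_or_lt with h | h
  · subst h; rw [cutS_of_shell (by linarith) le_rfl, one_mul]
  · unfold cutS
    rw [if_neg (by linarith), if_neg (by linarith), if_neg (by linarith)]
    exact div_mul_cancel₀ _ (hr.trans h).ne'

theorem cutS_of_le {r ρ : ℝ} (h : ρ ≤ r - 1) : cutS r ρ = max 0 (ρ - r + 2) := by
  unfold cutS
  split_ifs with h1 h2 h3
  · rw [max_eq_left (by linarith)]
  · rw [max_eq_right (by linarith)]
  · rw [max_eq_right (by linarith)]; linarith
  · linarith

/-- The radial profile `ρ ↦ t(ρ) + s(ρ) ρ` is nondecreasing. -/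
theorem cutT_add_cutS_mul_mono {r ρ σ : ℝ} (hr : 0 < r) (hρ : 0 ≤ ρ) (h : ρ ≤ σ) :
    cutT r ρ + cutS r ρ * ρ ≤ cutT r σ + cutS r σ * σ := by
  have inner_part : ∀ {a b : ℝ}, 0 ≤ a → a ≤ b → b ≤ r - 1 →
      cutT r a + cutS r a * a ≤ cutT r b + cutS r b * b := by
    intro a b ha hab hb
    rw [cutS_of_le (hab.trans hb), cutS_of_le hb]
    have h1 : cutT r a = 1 := by unfold cutT; rw [if_pos (hab.trans hb)]
    have h2 : cutT r b = 1 := by unfold cutT; rw [if_pos hb]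
    have h3 : max 0 (a - r + 2) ≤ max 0 (b - r + 2) := max_le_max le_rfl (by linarith)
    have h4 : 0 ≤ max 0 (b - r + 2) := le_max_left _ _
    rw [h1, h2]
    nlinarith
  -- From `r - 1` on the profile is constant: `(r - ρ) + ρ` in the shell, and `s(ρ) ρ = r` beyond
  -- it.
  have outer_part : ∀ {a : ℝ}, r - 1 ≤ a → cutT r a + cutS r a * a = r := by
    intro a ha
    rcases le_or_gt a r with har | har
    · rw [cutS_of_shell ha har]
      unfold cutT
      split_ifs <;> linarith
    · rw [cutT_eq_zero har.le, cutS_mul_of_ge hr har.le]; ring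
  rcases le_or_gt σ (r - 1) with hσ | hσ
  · exact inner_part hρ h hσ
  · rw [outer_part hσ.le]
    rcases le_or_gt ρ (r - 1) with hρ1 | hρ1
    · exact (inner_part hρ hρ1 le_rfl).trans_eq (outer_part le_rfl)
    · rw [outer_part hρ1.le]

/-- `t` is 1-Lipschitz and decreases only in the shell, where `s = 1`, so an endpoint in the shell
suffices. If the interval jumps over the shell, `s(σ) σ = r` gives `s(σ) (σ - ρ) ≥ r - ρ ≥ 1`, the
largest possible drop of `t`. -/
theorem cutT_sub_le_cutS_mul {r ρ σ : ℝ} (hr : 0 < r) (hρ : 0 ≤ ρ) (h : ρ ≤ σ) :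
    cutT r ρ - cutT r σ ≤ cutS r ρ * (σ - ρ) ∨ cutT r ρ - cutT r σ ≤ cutS r σ * (σ - ρ) := by
  have hτ := cutT_sub_le (r := r) h
  rcases le_or_gt r ρ with h1 | h1
  · left
    rw [cutT_eq_zero h1, cutT_eq_zero (h1.trans h)]
    have := mul_nonneg (cutS_nonneg (ρ := ρ) hr) (sub_nonneg.2 h)
    linarith
  rcases le_or_gt (r - 1) ρ with h2 | h2
  · left; rw [cutS_of_shell h2 h1.le]; linarith
  right
  rcases le_or_gt σ r with h3 | h3
  · rcases le_or_gt σ (r - 1) with h4 | h4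
    · have := mul_nonneg (cutS_nonneg (ρ := σ) hr) (sub_nonneg.2 h)
      have e1 : cutT r ρ = 1 := by unfold cutT; rw [if_pos h2.le]
      have e2 : cutT r σ = 1 := by unfold cutT; rw [if_pos h4]
      linarith
    · rw [cutS_of_shell h4.le h3]; linarith
  · have h5 := cutS_mul_of_ge hr h3.le
    have h6 := cutS_le_one (ρ := σ) hr
    have h7 := cutT_le_one (r := r) (ρ := ρ)
    have h8 := cutT_nonneg (r := r) (ρ := σ)
    nlinarith

/-- Up to radius `r` the function `s` is 1-Lipschitz, which costs a factor `r`; beyond it `s(ρ) ρ`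
is constant, which costs a factor 1. -/
theorem abs_cutS_sub_mul_le {r ρ σ : ℝ} (hr : 0 < r) (hρ : 0 ≤ ρ) (h : ρ ≤ σ) :
    |cutS r ρ - cutS r σ| * ρ ≤ (r + 1) * (σ - ρ) := by
  have ball_part : ∀ {a b : ℝ}, a ≤ b → b ≤ r → |cutS r a - cutS r b| ≤ b - a := by
    intro a b hab hb
    rw [abs_le]
    unfold cutS
    split_ifs <;> constructor <;> linarith
  have outside : ∀ {a b : ℝ}, r ≤ a → a ≤ b → |cutS r a - cutS r b| * a ≤ b - a := by
    intro a b ha hab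
    have h1 := cutS_mul_of_ge hr ha
    have h2 := cutS_mul_of_ge hr (ha.trans hab)
    have h3 := cutS_le_one (ρ := b) hr
    have h4 := cutS_nonneg (ρ := b) hr
    rw [← abs_of_pos (lt_of_lt_of_le hr ha), ← abs_mul, abs_of_pos (lt_of_lt_of_le hr ha), sub_mul,
      abs_le]
    constructor <;> nlinarith
  rcases le_or_gt σ r with h1 | h1
  · have := ball_part h h1
    nlinarith [abs_nonneg (cutS r ρ - cutS r σ)]
  rcases le_or_gt r ρ with h2 | h2
  · have := outside h2 h
    nlinarith
  · have e1 := ball_part h2.le le_rfl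
    have e2 := outside (le_refl r) h1.le
    have e3 : |cutS r ρ - cutS r σ| ≤ |cutS r ρ - cutS r r| + |cutS r r - cutS r σ| :=
      abs_sub_le _ _ _
    have e4 := abs_nonneg (cutS r r - cutS r σ)
    have e5 : |cutS r ρ - cutS r σ| * ρ
        ≤ (|cutS r ρ - cutS r r| + |cutS r r - cutS r σ|) * r :=
      mul_le_mul e3 h2.le hρ (by positivity)
    nlinarith

end Cutoff

/-! ### Cocoercivity of the radial part -/

section RadialPart

/-- The left side is `|a x - b y|²` for vectors of norms `ρ`, `σ` at distance `D`. Its radial part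
is at most `(N δ - R τ)²` with `δ = σ - ρ`, because `t + s ρ` is nondecreasing. Going from `δ` to
`D` adds `a b (D² - δ²)` on the left and `(D - δ) (N² (D + δ) - 2 N R τ)` on the right, so it
remains to compare these two. The alternative `hmax` serves that comparison. -/
theorem radial_scalar_bound {N R s s' ρ σ τ D a b : ℝ} (hN : 0 ≤ N) (hR : 0 ≤ R)
    (hRN : R ≤ N) (hs : 0 ≤ s) (hs1 : s ≤ 1) (hs' : 0 ≤ s') (hs'1 : s' ≤ 1) (hρσ : ρ ≤ σ) (hD : σ - ρ ≤ D)
    (hφ : τ ≤ s' * σ - s * ρ) (hφN : R * (s' * σ - s * ρ) ≤ N * (σ - ρ))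
    (hmax : τ ≤ s * (σ - ρ) ∨ τ ≤ s' * (σ - ρ)) (ha : a = N - R * s) (hb : b = N - R * s') :
    (a * ρ - b * σ) ^ 2 + a * b * (D ^ 2 - (σ - ρ) ^ 2) ≤ (N * D - R * τ) ^ 2 := by
  set δ := σ - ρ with hδ
  have hδ0 : 0 ≤ δ := by rw [hδ]; linarith
  have ha0 : 0 ≤ a := by rw [ha]; nlinarith
  have hb0 : 0 ≤ b := by rw [hb]; nlinarith
  have haN : a ≤ N := by rw [ha]; nlinarith
  have hbN : b ≤ N := by rw [hb]; nlinarith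
  have e1 : b * σ - a * ρ = N * δ - R * (s' * σ - s * ρ) := by rw [ha, hb, hδ]; ring
  have h1 : 0 ≤ b * σ - a * ρ := by rw [e1]; linarith
  have h2 : b * σ - a * ρ ≤ N * δ - R * τ := by
    rw [e1]; nlinarith
  have h3 : (a * ρ - b * σ) ^ 2 ≤ (N * δ - R * τ) ^ 2 := by nlinarith
  have h4 : 2 * N * (R * τ) ≤ (N ^ 2 - a * b) * (D + δ) := by
    have key : ∀ q : ℝ, 0 ≤ q → τ ≤ q * δ → N * (R * q) ≤ N ^ 2 - a * b →
        2 * N * (R * τ) ≤ (N ^ 2 - a * b) * (D + δ) := by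
      intro q hq hτq hab
      have h5 : N * (R * q) * (2 * δ) ≤ (N ^ 2 - a * b) * (D + δ) :=
        mul_le_mul hab (by linarith) (by linarith) (le_trans (by positivity) hab)
      have h6 : N * R * τ ≤ N * R * (q * δ) := mul_le_mul_of_nonneg_left hτq (by positivity)
      nlinarith
    rcases hmax with h | h
    · refine key s hs h ?_
      have : a * b ≤ a * N := mul_le_mul_of_nonneg_left hbN ha0
      rw [ha] at this ⊢
      nlinarith
    · refine key s' hs' h ?_
      have : a * b ≤ N * b := mul_le_mul_of_nonneg_right haN hb0
      rw [hb] at this ⊢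
      nlinarith
  have h5 : 0 ≤ (D - δ) * ((N ^ 2 - a * b) * (D + δ) - 2 * N * (R * τ)) :=
    mul_nonneg (by linarith) (by linarith)
  nlinarith

variable {V : Type*} [NormedAddCommGroup V] [InnerProductSpace ℝ V]

theorem norm_smul_sub_smul_sq (a b : ℝ) (x y : V) :
    ‖a • x - b • y‖ ^ 2 =
      (a * ‖x‖ - b * ‖y‖) ^ 2 + a * b * (‖x - y‖ ^ 2 - (‖y‖ - ‖x‖) ^ 2) := by
  rw [@norm_sub_sq_real, @norm_sub_sq_real, norm_smul, norm_smul, mul_pow, mul_pow,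
    Real.norm_eq_abs, Real.norm_eq_abs, sq_abs, sq_abs, real_inner_smul_left,
    real_inner_smul_right]
  ring

/-- Expanding the square shows that cocoercivity says that `K` lies in the ball of centre `N • v`
and radius `N ‖v‖`. Unlike the quadratic form, this version can be combined by the triangle
inequality. -/
theorem cocoercive_of_norm_sub_le {N : ℝ} (hN : 0 ≤ N) {K v : V} (h : ‖N • v - K‖ ≤ N * ‖v‖) :
    ‖K‖ ^ 2 ≤ 2 * N * inner ℝ K v := by
  have h1 : ‖N • v - K‖ ^ 2 ≤ (N * ‖v‖) ^ 2 := pow_le_pow_left₀ (norm_nonneg _) h 2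
  rw [@norm_sub_sq_real, norm_smul, real_inner_smul_left, Real.norm_eq_abs, abs_of_nonneg hN,
    real_inner_comm] at h1
  linarith

/-- Cocoercivity of the radial part of the tamed drift, combined with the increment of the
cut-off `t`. -/
theorem radial_cocoercive {r N R : ℝ} (hr : 0 < r) (hR : 0 ≤ R) (hRN : R ≤ N)
    (hφN : ∀ ρ σ : ℝ, 0 ≤ ρ → ρ ≤ σ → R * (cutS r σ * σ - cutS r ρ * ρ) ≤ N * (σ - ρ))
    {x y e : V} (hxy : ‖x‖ ≤ ‖y‖) (he : ‖(cutT r ‖x‖ - cutT r ‖y‖) • e‖ ≤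
      R * (cutT r ‖x‖ - cutT r ‖y‖)) :
    ‖(R * cutS r ‖x‖) • x - (R * cutS r ‖y‖) • y + (cutT r ‖x‖ - cutT r ‖y‖) • e‖ ^ 2 ≤
      2 * N * inner ℝ ((R * cutS r ‖x‖) • x - (R * cutS r ‖y‖) • y +
        (cutT r ‖x‖ - cutT r ‖y‖) • e) (x - y) := by
  have hN : 0 ≤ N := hR.trans hRN
  set τ := cutT r ‖x‖ - cutT r ‖y‖ with hτ
  have hρ := norm_nonneg x
  have hτ0 : 0 ≤ τ := sub_nonneg.2 (cutT_antitone hxy)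
  have hτ1 : τ ≤ ‖y‖ - ‖x‖ := cutT_sub_le hxy
  have hD : ‖y‖ - ‖x‖ ≤ ‖x - y‖ := by rw [norm_sub_rev]; exact norm_sub_norm_le _ _
  have hb := radial_scalar_bound (a := N - R * cutS r ‖x‖) (b := N - R * cutS r ‖y‖) hN hR hRN
    (cutS_nonneg hr) (cutS_le_one hr) (cutS_nonneg hr) (cutS_le_one hr) hxy hD
    (by linarith [cutT_add_cutS_mul_mono hr hρ hxy]) (hφN _ _ hρ hxy)
    (cutT_sub_le_cutS_mul hr hρ hxy) rfl rfl
  rw [← norm_smul_sub_smul_sq] at hb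
  have hpos : 0 ≤ N * ‖x - y‖ - R * τ := by nlinarith
  have hb' := abs_le_of_sq_le_sq hb hpos
  rw [abs_norm] at hb'
  apply cocoercive_of_norm_sub_le hN
  have e1 : N • (x - y) - ((R * cutS r ‖x‖) • x - (R * cutS r ‖y‖) • y + τ • e) =
      ((N - R * cutS r ‖x‖) • x - (N - R * cutS r ‖y‖) • y) - τ • e := by module
  rw [e1]
  refine (norm_sub_le _ _).trans ?_
  linarith

end RadialPart

/-! ### Baillon-Haddad theorem on a ball -/

section BaillonHaddad

variable {V : Type*} [NormedAddCommGroup V] [InnerProductSpace ℝ V] [CompleteSpace V]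

/-- Along the segment, `w` minus the claimed quadratic has nonpositive derivative. No sign of `c` is
required, so `-w` with `c = 0` yields the tangent inequality for convex functions. -/
theorem le_taylor_of_inner_gradient_le {w : V → ℝ} {g : V → V} {S : Set V} (hS : Convex ℝ S)
    (hw : ∀ z ∈ S, HasGradientAt w (g z) z) {c : ℝ}
    (hg : ∀ x ∈ S, ∀ y ∈ S, inner ℝ (g x - g y) (x - y) ≤ c * ‖x - y‖ ^ 2)
    {x y : V} (hx : x ∈ S) (hy : y ∈ S) :
    w y ≤ w x + inner ℝ (g x) (y - x) + c / 2 * ‖y - x‖ ^ 2 := by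
  set p : ℝ → V := fun s => x + s • (y - x) with hp
  have hpS : ∀ s ∈ Set.Icc (0 : ℝ) 1, p s ∈ S := fun s hs => by
    have := hS.add_smul_sub_mem hx hy hs
    simpa [hp] using this
  have hder : ∀ s ∈ Set.Icc (0 : ℝ) 1, HasDerivAt
      (fun s => w (p s) - s * inner ℝ (g x) (y - x) - s ^ 2 * (c / 2 * ‖y - x‖ ^ 2))
      (inner ℝ (g (p s)) (y - x) - inner ℝ (g x) (y - x) - 2 * s * (c / 2 * ‖y - x‖ ^ 2)) s := by
    intro s hs
    have h1 : HasDerivAt p (y - x) s := by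
      have := ((hasDerivAt_id s).smul_const (y - x)).const_add x
      simpa [hp] using this
    have h2 := (hw _ (hpS s hs)).hasFDerivAt.comp_hasDerivAt s h1
    have h3 : HasDerivAt (fun s => w (p s)) (inner ℝ (g (p s)) (y - x)) s := by
      simpa [Function.comp_def] using h2
    have h4 := (hasDerivAt_id s).mul_const (inner ℝ (g x) (y - x))
    have h5 := (hasDerivAt_pow 2 s).mul_const (c / 2 * ‖y - x‖ ^ 2)
    refine ((h3.sub h4).sub h5).congr_deriv ?_
    simp
  have hanti : AntitoneOn
      (fun s => w (p s) - s * inner ℝ (g x) (y - x) - s ^ 2 * (c / 2 * ‖y - x‖ ^ 2))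
      (Set.Icc 0 1) := by
    apply antitoneOn_of_deriv_nonpos (convex_Icc 0 1)
    · exact fun s hs => (hder s hs).continuousAt.continuousWithinAt
    · exact fun s hs => (hder s (interior_subset hs)).differentiableAt.differentiableWithinAt
    · intro s hs
      rw [interior_Icc] at hs
      have hs' := Set.Ioo_subset_Icc_self hs
      rw [(hder s hs').deriv]
      have h6 := hg _ (hpS s hs') x hx
      have e1 : p s - x = s • (y - x) := by simp [hp]
      rw [e1, norm_smul, inner_smul_right, inner_sub_left, Real.norm_eq_abs,
        abs_of_pos hs.1] at h6
      have h7 : s * (inner ℝ (g (p s)) (y - x) - inner ℝ (g x) (y - x)) ≤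
          s * (s * (c * ‖y - x‖ ^ 2)) := by linarith
      linarith [le_of_mul_le_mul_left h7 hs.1]
  have := hanti (Set.left_mem_Icc.2 zero_le_one) (Set.right_mem_Icc.2 zero_le_one) zero_le_one
  simp [hp] at this
  linarith

/-- The gradient of a convex function whose gradient is one-sided Lipschitz is cocoercive, for
pairs of points whose gradient steps stay in the domain. -/
theorem gradient_cocoercive_of_mem {w : V → ℝ} {g : V → V} {S : Set V} (hS : Convex ℝ S)
    (hw : ∀ z ∈ S, HasGradientAt w (g z) z) {c : ℝ} (hc : 0 < c)
    (hmono : ∀ x ∈ S, ∀ y ∈ S, 0 ≤ inner ℝ (g x - g y) (x - y))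
    (hg : ∀ x ∈ S, ∀ y ∈ S, inner ℝ (g x - g y) (x - y) ≤ c * ‖x - y‖ ^ 2)
    {x y : V} (hx : x ∈ S) (hy : y ∈ S) (hx' : x - c⁻¹ • (g x - g y) ∈ S)
    (hy' : y - c⁻¹ • (g y - g x) ∈ S) :
    ‖g x - g y‖ ^ 2 ≤ c * inner ℝ (g x - g y) (x - y) := by
  have convex_part : ∀ a ∈ S, ∀ b ∈ S, w a + inner ℝ (g a) (b - a) ≤ w b := by
    intro a ha b hb
    have := le_taylor_of_inner_gradient_le (w := fun z => - w z) (g := fun z => - g z) (c := 0) hS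
      (fun z hz => by
        have := (hw z hz).hasFDerivAt.neg
        rw [hasGradientAt_iff_hasFDerivAt, map_neg]
        exact this)
      (fun x hx y hy => by
        have := hmono x hx y hy
        have e : -g x - -g y = -(g x - g y) := by abel
        rw [e, inner_neg_left]; linarith) ha hb
    rw [inner_neg_left] at this
    linarith
  -- A gradient step of length `c⁻¹` from `b` for the convex function `w - ⟨g a, ·⟩`, which is
  -- minimal at `a`, lowers it by at least `(2 c)⁻¹ ‖g b - g a‖²`. Adding the inequality with `a`
  -- and `b` exchanged gives cocoercivity.
  have half : ∀ a ∈ S, ∀ b ∈ S, b - c⁻¹ • (g b - g a) ∈ S →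
      w a + inner ℝ (g a) (b - a) + (2 * c)⁻¹ * ‖g b - g a‖ ^ 2 ≤ w b := by
    intro a ha b hb hb'
    have h1 := convex_part a ha _ hb'
    have h2 := le_taylor_of_inner_gradient_le hS hw hg hb hb'
    have e1 : b - c⁻¹ • (g b - g a) - b = -(c⁻¹ • (g b - g a)) := by abel
    have e2 : b - c⁻¹ • (g b - g a) - a = (b - a) - c⁻¹ • (g b - g a) := by abel
    rw [e1, inner_neg_right, norm_neg, norm_smul, inner_smul_right, Real.norm_eq_abs,
      abs_of_pos (inv_pos.2 hc)] at h2
    rw [e2, inner_sub_right, inner_smul_right] at h1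
    have e3 : inner ℝ (g b) (g b - g a) - inner ℝ (g a) (g b - g a) = ‖g b - g a‖ ^ 2 := by
      rw [← inner_sub_left, real_inner_self_eq_norm_sq]
    have e4 : c / 2 * (c⁻¹ * ‖g b - g a‖) ^ 2 = (2 * c)⁻¹ * ‖g b - g a‖ ^ 2 := by
      field_simp
    have e5 : c⁻¹ * ‖g b - g a‖ ^ 2 = 2 * ((2 * c)⁻¹ * ‖g b - g a‖ ^ 2) := by
      field_simp
    rw [e4] at h2
    have e6 : c⁻¹ * inner ℝ (g b) (g b - g a) - c⁻¹ * inner ℝ (g a) (g b - g a) =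
        2 * ((2 * c)⁻¹ * ‖g b - g a‖ ^ 2) := by rw [← e5, ← e3]; ring
    linarith
  have h1 := half x hx y hy hy'
  have h2 := half y hy x hx hx'
  rw [norm_sub_rev (g y) (g x)] at h1
  have e1 : inner ℝ (g x) (y - x) + inner ℝ (g y) (x - y) = - inner ℝ (g x - g y) (x - y) := by
    rw [inner_sub_left, ← neg_sub x y, inner_neg_right]; ring
  have h3 : 2 * ((2 * c)⁻¹ * ‖g x - g y‖ ^ 2) ≤ inner ℝ (g x - g y) (x - y) := by linarith
  have e2 : 2 * ((2 * c)⁻¹ * ‖g x - g y‖ ^ 2) = c⁻¹ * ‖g x - g y‖ ^ 2 := by field_simp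
  rw [e2, inv_mul_le_iff₀ hc] at h3
  exact h3

/-- A Baillon-Haddad theorem on a ball. -/
theorem gradient_cocoercive_on_ball {w : V → ℝ} {g : V → V} {σ : ℝ}
    (hw : ∀ z ∈ Metric.ball (0 : V) σ, HasGradientAt w (g z) z) {c C : ℝ} (hc : 0 < c)
    (hC : ∀ x ∈ Metric.ball (0 : V) σ, ∀ y ∈ Metric.ball (0 : V) σ,
      ‖g x - g y‖ ≤ C * ‖x - y‖)
    (hmono : ∀ x ∈ Metric.ball (0 : V) σ, ∀ y ∈ Metric.ball (0 : V) σ,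
      0 ≤ inner ℝ (g x - g y) (x - y))
    (hg : ∀ x ∈ Metric.ball (0 : V) σ, ∀ y ∈ Metric.ball (0 : V) σ,
      inner ℝ (g x - g y) (x - y) ≤ c * ‖x - y‖ ^ 2)
    {x y : V} (hx : x ∈ Metric.ball (0 : V) σ) (hy : y ∈ Metric.ball (0 : V) σ) :
    ‖g x - g y‖ ^ 2 ≤ c * inner ℝ (g x - g y) (x - y) := by
  have hconv : Convex ℝ (Metric.ball (0 : V) σ) := convex_ball 0 σ
  set ρ := max ‖x‖ ‖y‖ with hρ
  have hρσ : ρ < σ := max_lt (by simpa using hx) (by simpa using hy)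
  -- For close points the gradient steps have length at most `c⁻¹ C ‖a - b‖ < σ - ρ` and stay in the
  -- ball. Cocoercivity then says that `(c / 2) • id - g` does not expand by more than `c / 2`, a
  -- property that adds up along a segment. The constant `C` only fixes how finely the segment is
  -- cut.
  have hsub : ∀ a b : V, ‖a‖ ≤ ρ → ‖b‖ ≤ ρ → c⁻¹ * (C * ‖a - b‖) < σ - ρ →
      ‖(c / 2) • (a - b) - (g a - g b)‖ ≤ c / 2 * ‖a - b‖ := by
    intro a b ha hb hab
    have haS : a ∈ Metric.ball (0 : V) σ := by simpa using ha.trans_lt hρσ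
    have hbS : b ∈ Metric.ball (0 : V) σ := by simpa using hb.trans_lt hρσ
    have step : ∀ p q : V, ‖p‖ ≤ ρ → p ∈ Metric.ball (0 : V) σ → q ∈ Metric.ball (0 : V) σ →
        ‖p - q‖ = ‖a - b‖ → p - c⁻¹ • (g p - g q) ∈ Metric.ball (0 : V) σ := by
      intro p q hp hpS hqS hpq
      rw [mem_ball_zero_iff]
      calc ‖p - c⁻¹ • (g p - g q)‖ ≤ ‖p‖ + ‖c⁻¹ • (g p - g q)‖ := norm_sub_le _ _
        _ = ‖p‖ + c⁻¹ * ‖g p - g q‖ := by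
          rw [norm_smul, Real.norm_eq_abs, abs_of_pos (inv_pos.2 hc)]
        _ ≤ ρ + c⁻¹ * (C * ‖a - b‖) := by
          have := mul_le_mul_of_nonneg_left (hC p hpS q hqS) (inv_pos.2 hc).le
          rw [hpq] at this
          linarith
        _ < σ := by linarith
    have h1 := gradient_cocoercive_of_mem hconv hw hc hmono hg haS hbS
      (step a b ha haS hbS rfl) (step b a hb hbS haS (norm_sub_rev _ _))
    apply abs_le_of_sq_le_sq' _ (by positivity) |>.2
    rw [@norm_sub_sq_real, norm_smul, real_inner_smul_left, Real.norm_eq_abs,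
      abs_of_pos (by positivity : 0 < c / 2), real_inner_comm]
    linarith
  obtain ⟨n, hn⟩ := exists_nat_gt (c⁻¹ * (C * ‖x - y‖) / (σ - ρ))
  have hn' : c⁻¹ * (C * ‖x - y‖) / (σ - ρ) < (n + 1 : ℕ) := hn.trans (by simp)
  set k : ℕ := n + 1 with hk
  have hk0 : (0 : ℝ) < k := by positivity
  rw [div_lt_iff₀ (by linarith)] at hn'
  set p : ℕ → V := fun i => y + ((i : ℝ) / k) • (x - y) with hp
  have hpρ : ∀ i ≤ k, ‖p i‖ ≤ ρ := by
    intro i hi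
    have h0 : (0 : ℝ) ≤ i / k := by positivity
    have h1 : (i : ℝ) / k ≤ 1 := by
      rw [div_le_one hk0]; exact_mod_cast hi
    have e : p i = (1 - (i : ℝ) / k) • y + ((i : ℝ) / k) • x := by simp only [hp]; module
    rw [e]
    refine (norm_add_le _ _).trans ?_
    rw [norm_smul, norm_smul, Real.norm_eq_abs, Real.norm_eq_abs, abs_of_nonneg h0,
      abs_of_nonneg (by linarith)]
    have := le_max_left ‖x‖ ‖y‖
    have := le_max_right ‖x‖ ‖y‖
    nlinarith
  have hdiff : ∀ i : ℕ, p (i + 1) - p i = (1 / (k : ℝ)) • (x - y) := by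
    intro i
    simp only [hp]
    push_cast
    rw [add_div]
    module
  have hnorm : ∀ i : ℕ, ‖p (i + 1) - p i‖ = ‖x - y‖ / k := by
    intro i
    rw [hdiff, norm_smul, Real.norm_eq_abs, abs_of_pos (by positivity)]
    ring
  have htot : ∀ i ≤ k, ‖(c / 2) • (p i - p 0) - (g (p i) - g (p 0))‖ ≤
      i * (c / 2 * (‖x - y‖ / k)) := by
    intro i
    induction i with
    | zero => simp
    | succ i ih =>
      intro hi
      have h1 := ih (by omega)
      have h2 := hsub (p (i + 1)) (p i) (hpρ _ hi) (hpρ _ (by omega)) (by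
        rw [hnorm]
        have e : c⁻¹ * (C * (‖x - y‖ / k)) = c⁻¹ * (C * ‖x - y‖) / k := by ring
        rw [e, div_lt_iff₀ hk0]
        linarith)
      rw [hnorm] at h2
      have e : (c / 2) • (p (i + 1) - p 0) - (g (p (i + 1)) - g (p 0)) =
          ((c / 2) • (p i - p 0) - (g (p i) - g (p 0))) +
          ((c / 2) • (p (i + 1) - p i) - (g (p (i + 1)) - g (p i))) := by module
      rw [e]
      refine (norm_add_le _ _).trans ?_
      push_cast
      linarith
  have hfin := htot k le_rfl
  have e0 : p 0 = y := by simp [hp]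
  have e1 : p k = x := by simp [hp, hk0.ne']
  rw [e0, e1] at hfin
  have e2 : (k : ℝ) * (c / 2 * (‖x - y‖ / k)) = c / 2 * ‖x - y‖ := by field_simp
  rw [e2] at hfin
  have := cocoercive_of_norm_sub_le (by positivity) hfin
  linarith

end BaillonHaddad

/-! ### Lipschitz continuity of the tamed drift -/

section Drift

variable {d : ℕ} {h : E d → E d} {m L l r : ℝ}

/-- The tamed drift at a general taming radius. -/
noncomputable def tamedDriftAt (h : E d → E d) (m r : ℝ) (x : E d) : E d :=
  cutT r ‖x‖ • gDrift h m x + (tamingSup h m r * cutS r ‖x‖) • x + m • x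

theorem gDrift_lipschitz_on_ball (hlip : PolyLipschitz h L l) (hL : 0 < L) (hl : 0 < l)
    (hm : 0 < m) {x y : E d} (hx : ‖x‖ ≤ r) (hy : ‖y‖ ≤ r) :
    ‖gDrift h m x - gDrift h m y‖ ≤ (L * (1 + r + r) ^ l + m) * ‖x - y‖ := by
  have e : gDrift h m x - gDrift h m y = (h x - h y) - m • (x - y) := by
    unfold gDrift; module
  rw [e]
  refine (norm_sub_le _ _).trans ?_
  rw [norm_smul, Real.norm_eq_abs, abs_of_pos hm, add_mul]
  gcongr
  refine (hlip x y).trans ?_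
  gcongr

theorem gDrift_strongMonotone (hconv : StrongMonotone h m) (x y : E d) :
    m * ‖x - y‖ ^ 2 ≤ inner ℝ (gDrift h m x - gDrift h m y) (x - y) := by
  have e : gDrift h m x - gDrift h m y = (h x - h y) - m • (x - y) := by
    unfold gDrift; module
  rw [e, inner_sub_left, real_inner_smul_left, real_inner_self_eq_norm_sq]
  linarith [hconv x y]

theorem norm_gDrift_le (hlip : PolyLipschitz h L l) (hL : 0 < L) (hl : 0 < l)
    (hm : 0 < m) {x : E d} (hx : ‖x‖ < r) : ‖gDrift h m x‖ ≤ tamingSup h m r := by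
  apply le_csSup
  -- The image must be bounded for `sSup` to be a supremum; on an unbounded set it takes the default
  -- value 0.
  · refine ⟨‖gDrift h m 0‖ + (L * (1 + r + r) ^ l + m) * r, ?_⟩
    rintro _ ⟨y, hy, rfl⟩
    have hr : 0 ≤ r := (norm_nonneg x).trans hx.le
    have hy' : ‖y‖ ≤ r := (mem_ball_zero_iff.1 hy).le
    have h1 := gDrift_lipschitz_on_ball hlip hL hl hm hy' (y := 0) (by simpa using hr)
    rw [sub_zero] at h1
    have h2 := norm_le_norm_add_norm_sub' (gDrift h m y) (gDrift h m 0)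
    have h3 : (L * (1 + r + r) ^ l + m) * ‖y‖ ≤ (L * (1 + r + r) ^ l + m) * r := by gcongr
    dsimp only
    linarith
  · exact ⟨x, by simpa using hx, rfl⟩

theorem tamingSup_nonneg : 0 ≤ tamingSup h m r := by
  apply Real.sSup_nonneg
  rintro _ ⟨y, _, rfl⟩
  exact norm_nonneg _

theorem norm_cutT_smul_gDrift_le (hlip : PolyLipschitz h L l) (hL : 0 < L) (hl : 0 < l)
    (hm : 0 < m) {x y : E d} (hxy : ‖x‖ ≤ ‖y‖) :
    ‖(cutT r ‖x‖ - cutT r ‖y‖) • gDrift h m x‖ ≤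
      tamingSup h m r * (cutT r ‖x‖ - cutT r ‖y‖) := by
  have h0 : 0 ≤ cutT r ‖x‖ - cutT r ‖y‖ := sub_nonneg.2 (cutT_antitone hxy)
  rw [norm_smul, Real.norm_eq_abs, abs_of_nonneg h0, mul_comm]
  rcases lt_or_ge ‖x‖ r with hx | hx
  · exact mul_le_mul_of_nonneg_right (norm_gDrift_le hlip hL hl hm hx) h0
  · rw [cutT_eq_zero hx, cutT_eq_zero (hx.trans hxy)]; simp

/-- The increment of the radial part of the tamed drift, with the increment of `t`. -/
noncomputable def radialIncr (h : E d → E d) (m r : ℝ) (x y : E d) : E d :=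
  (tamingSup h m r * cutS r ‖x‖) • x - (tamingSup h m r * cutS r ‖y‖) • y +
    (cutT r ‖x‖ - cutT r ‖y‖) • gDrift h m x

theorem tamedDriftAt_sub (x y : E d) :
    tamedDriftAt h m r x - tamedDriftAt h m r y = m • (x - y) +
      (cutT r ‖y‖ • (gDrift h m x - gDrift h m y) + radialIncr h m r x y) := by
  unfold tamedDriftAt radialIncr
  module

theorem norm_tamedDriftAt_sub_le (hlip : PolyLipschitz h L l) (hL : 0 < L) (hl : 0 < l)
    (hm : 0 < m) (hr : 0 < r) {x y : E d} (hxy : ‖x‖ ≤ ‖y‖) :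
    ‖tamedDriftAt h m r x - tamedDriftAt h m r y‖ ≤
      (m + (L * (1 + r + r) ^ l + m) + tamingSup h m r * (r + 3)) * ‖x - y‖ := by
  have hR : 0 ≤ tamingSup h m r := tamingSup_nonneg
  have hD : ‖y‖ - ‖x‖ ≤ ‖x - y‖ := by rw [norm_sub_rev]; exact norm_sub_norm_le _ _
  have h1 : ‖cutT r ‖y‖ • (gDrift h m x - gDrift h m y)‖ ≤
      (L * (1 + r + r) ^ l + m) * ‖x - y‖ := by
    rw [norm_smul, Real.norm_eq_abs, abs_of_nonneg cutT_nonneg]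
    rcases lt_or_ge ‖y‖ r with hy | hy
    · have := gDrift_lipschitz_on_ball hlip hL hl hm (hxy.trans hy.le) hy.le
      refine le_trans ?_ this
      exact mul_le_of_le_one_left (norm_nonneg _) cutT_le_one
    · rw [cutT_eq_zero hy, zero_mul]; positivity
  have h2 := norm_cutT_smul_gDrift_le (r := r) hlip hL hl hm hxy
  have h3 : ‖(tamingSup h m r * cutS r ‖x‖) • x - (tamingSup h m r * cutS r ‖y‖) • y‖ ≤
      tamingSup h m r * ((r + 2) * ‖x - y‖) := by
    have e : (tamingSup h m r * cutS r ‖x‖) • x - (tamingSup h m r * cutS r ‖y‖) • y =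
        tamingSup h m r • ((cutS r ‖x‖ - cutS r ‖y‖) • x + cutS r ‖y‖ • (x - y)) := by module
    rw [e, norm_smul, Real.norm_eq_abs, abs_of_nonneg hR]
    gcongr
    refine (norm_add_le _ _).trans ?_
    rw [norm_smul, norm_smul, Real.norm_eq_abs, Real.norm_eq_abs,
      abs_of_nonneg (cutS_nonneg hr)]
    have h4 := abs_cutS_sub_mul_le hr (norm_nonneg x) hxy
    have h5 : cutS r ‖y‖ * ‖x - y‖ ≤ ‖x - y‖ :=
      mul_le_of_le_one_left (norm_nonneg _) (cutS_le_one hr)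
    have h6 : (r + 1) * (‖y‖ - ‖x‖) ≤ (r + 1) * ‖x - y‖ := by gcongr
    linarith
  have h4 : tamingSup h m r * (cutT r ‖x‖ - cutT r ‖y‖) ≤ tamingSup h m r * ‖x - y‖ := by
    gcongr
    exact (cutT_sub_le hxy).trans hD
  rw [tamedDriftAt_sub]
  refine (norm_add_le _ _).trans ?_
  refine (add_le_add_right (norm_add_le _ _) _).trans ?_
  unfold radialIncr
  refine (add_le_add_right (add_le_add_right (norm_add_le _ _) _) _).trans ?_
  rw [norm_smul m, Real.norm_eq_abs, abs_of_pos hm]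
  linarith

/-- Only finiteness matters: without some Lipschitz constant, `lipConst` would be the infimum of the
empty set, which is 0, and the hypothesis on `M` would say nothing. -/
theorem exists_lipschitzWith_tamedDriftAt (hlip : PolyLipschitz h L l) (hL : 0 < L) (hl : 0 < l)
    (hm : 0 < m) (hr : 0 < r) : ∃ K : ℝ≥0, LipschitzWith K (tamedDriftAt h m r) := by
  have hR : 0 ≤ tamingSup h m r := tamingSup_nonneg
  refine ⟨Real.toNNReal (m + (L * (1 + r + r) ^ l + m) + tamingSup h m r * (r + 3)),
    LipschitzWith.of_dist_le_mul fun x y => ?_⟩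
  rw [dist_eq_norm, dist_eq_norm, Real.coe_toNNReal _ (by positivity)]
  rcases le_total ‖x‖ ‖y‖ with hxy | hxy
  · exact norm_tamedDriftAt_sub_le hlip hL hl hm hr hxy
  · rw [norm_sub_rev, norm_sub_rev x y]
    exact norm_tamedDriftAt_sub_le hlip hL hl hm hr hxy

theorem lipschitzWith_lipConst {f : E d → E d} (hf : ∃ K : ℝ≥0, LipschitzWith K f) :
    LipschitzWith (lipConst f) f := by
  refine LipschitzWith.of_dist_le_mul fun x y => ?_
  rcases (dist_nonneg (x := x) (y := y)).eq_or_lt with h0 | h0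
  · obtain ⟨K, hK⟩ := hf
    have := hK.dist_le_mul x y
    rw [← h0] at this ⊢
    simpa using this
  · rw [← div_le_iff₀ h0]
    rw [← Real.toNNReal_le_iff_le_coe]
    refine le_csInf hf fun K hK => ?_
    rw [Real.toNNReal_le_iff_le_coe, div_le_iff₀ h0]
    exact hK.dist_le_mul x y

/-! ### Cocoercivity of the tamed drift -/

section Cocoercive

variable {M : ℝ}

theorem inner_tamedDriftAt_sub_le
    (hM : ∀ x y, ‖tamedDriftAt h m r x - tamedDriftAt h m r y‖ ≤ M * ‖x - y‖) (x y : E d) :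
    cutT r ‖y‖ * inner ℝ (gDrift h m x - gDrift h m y) (x - y) +
      inner ℝ (radialIncr h m r x y) (x - y) ≤ (M - m) * ‖x - y‖ ^ 2 := by
  have h1 := real_inner_le_norm (tamedDriftAt h m r x - tamedDriftAt h m r y) (x - y)
  have h2 : ‖tamedDriftAt h m r x - tamedDriftAt h m r y‖ * ‖x - y‖ ≤
      M * ‖x - y‖ * ‖x - y‖ := by gcongr; exact hM x y
  rw [tamedDriftAt_sub] at h1
  rw [tamedDriftAt_sub, inner_add_left, inner_add_left, real_inner_smul_left,
    real_inner_smul_left, real_inner_self_eq_norm_sq] at *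
  linarith

theorem exists_norm_eq_of_pos (hd : 0 < d) {ρ : ℝ} (hρ : 0 ≤ ρ) :
    ∃ e : E d, ‖e‖ = 1 ∧ ‖ρ • e‖ = ρ := by
  refine ⟨EuclideanSpace.single ⟨0, hd⟩ 1, by simp, ?_⟩
  rw [norm_smul, Real.norm_eq_abs, abs_of_nonneg hρ]; simp

/-- On the sphere of radius `r` one has `t = 0` and `s = 1`, so the drift is `(R + m) x` there; two
antipodal points show that its slope is at most `M`. Such points exist because `d ≥ 1`. -/
theorem tamingSup_le (hd : 0 < d) (hr : 0 < r)
    (hM : ∀ x y, ‖tamedDriftAt h m r x - tamedDriftAt h m r y‖ ≤ M * ‖x - y‖) :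
    tamingSup h m r ≤ M - m := by
  obtain ⟨e, he, hre⟩ := exists_norm_eq_of_pos hd hr.le
  have h1 := inner_tamedDriftAt_sub_le hM (r • e) (-(r • e))
  unfold radialIncr at h1
  rw [norm_neg, hre, cutT_eq_zero le_rfl, cutS_of_shell (by linarith) le_rfl] at h1
  have e1 : r • e - -(r • e) = (2 * r) • e := by module
  have e2 : (tamingSup h m r * 1) • r • e - (tamingSup h m r * 1) • -(r • e) +
      ((0 : ℝ) - 0) • gDrift h m (r • e) = (tamingSup h m r * (2 * r)) • e := by module
  rw [e1, e2, norm_smul, real_inner_smul_left, real_inner_smul_right (x := e) (y := e),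
    real_inner_self_eq_norm_sq, he, Real.norm_eq_abs, abs_of_pos (by positivity)] at h1
  have h2 : tamingSup h m r * (2 * r) ^ 2 ≤ (M - m) * (2 * r) ^ 2 := by linarith
  exact le_of_mul_le_mul_right h2 (by positivity)

/-- Up to radius `r - 1` one has `t = 1`, and the bound is read off from two points of a ray, where
`g` contributes a nonnegative amount. From `r - 1` on, `s(ρ) ρ` is 1-Lipschitz and `R ≤ M - m`
suffices. -/
theorem tamingSup_mul_profile_le (hd : 0 < d) (hm : 0 < m) (hr : 0 < r)
    (hconv : StrongMonotone h m)
    (hM : ∀ x y, ‖tamedDriftAt h m r x - tamedDriftAt h m r y‖ ≤ M * ‖x - y‖)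
    {ρ σ : ℝ} (hρ : 0 ≤ ρ) (hρσ : ρ ≤ σ) :
    tamingSup h m r * (cutS r σ * σ - cutS r ρ * ρ) ≤ (M - m) * (σ - ρ) := by
  have hRN := tamingSup_le hd hr hM
  have hR : 0 ≤ tamingSup h m r := tamingSup_nonneg
  have inner_part : ∀ {a b : ℝ}, 0 ≤ a → a ≤ b → b ≤ r - 1 →
      tamingSup h m r * (cutS r b * b - cutS r a * a) ≤ (M - m) * (b - a) := by
    intro a b ha hab hb
    rcases hab.eq_or_lt with rfl | hab
    · simp
    obtain ⟨e, he, hae⟩ := exists_norm_eq_of_pos hd ha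
    have hbe : ‖b • e‖ = b := by
      rw [norm_smul, he, Real.norm_eq_abs, abs_of_nonneg (ha.trans hab.le), mul_one]
    have h1 := inner_tamedDriftAt_sub_le hM (a • e) (b • e)
    have h2 := gDrift_strongMonotone hconv (a • e) (b • e)
    have e1 : a • e - b • e = -((b - a) • e) := by module
    have t1 : ∀ c : ℝ, c ≤ r - 1 → cutT r c = 1 := fun c hc => by unfold cutT; rw [if_pos hc]
    unfold radialIncr at h1
    rw [hae, hbe, t1 b hb, t1 a (hab.le.trans hb)] at h1
    have e2 : (tamingSup h m r * cutS r a) • a • e - (tamingSup h m r * cutS r b) • b • e +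
        ((1 : ℝ) - 1) • gDrift h m (a • e) =
        -((tamingSup h m r * (cutS r b * b - cutS r a * a)) • e) := by module
    have h3 : 0 ≤ m * ‖a • e - b • e‖ ^ 2 := by positivity
    have h4 : inner ℝ (-((tamingSup h m r * (cutS r b * b - cutS r a * a)) • e))
        (-((b - a) • e)) = tamingSup h m r * (cutS r b * b - cutS r a * a) * (b - a) := by
      rw [inner_neg_neg, real_inner_smul_left, real_inner_smul_right,
        real_inner_self_eq_norm_sq, he]; ring
    have h5 : ‖a • e - b • e‖ ^ 2 = (b - a) ^ 2 := by
      rw [e1, norm_neg, norm_smul, he, mul_one, Real.norm_eq_abs, sq_abs]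
    rw [e2, h5, e1, h4] at h1
    rw [e1] at h2 h3
    have h6 : tamingSup h m r * (cutS r b * b - cutS r a * a) * (b - a) ≤
        (M - m) * (b - a) * (b - a) := by linarith
    exact le_of_mul_le_mul_right h6 (by linarith)
  have shell : ∀ {a b : ℝ}, r - 1 ≤ a → a ≤ b →
      tamingSup h m r * (cutS r b * b - cutS r a * a) ≤ (M - m) * (b - a) := by
    intro a b ha hab
    have h1 : cutS r b * b - cutS r a * a ≤ b - a := by
      rcases le_or_gt r a with h1 | h1
      · rw [cutS_mul_of_ge hr h1, cutS_mul_of_ge hr (h1.trans hab)]; linarith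
      · rw [cutS_of_shell ha h1.le]
        rcases le_or_gt r b with h2 | h2
        · rw [cutS_mul_of_ge hr h2]; linarith
        · rw [cutS_of_shell (ha.trans hab) h2.le]; linarith
    exact (mul_le_mul_of_nonneg_left h1 hR).trans
      (mul_le_mul_of_nonneg_right hRN (sub_nonneg.2 hab))
  rcases le_or_gt σ (r - 1) with h1 | h1
  · exact inner_part hρ hρσ h1
  rcases le_or_gt (r - 1) ρ with h2 | h2
  · exact shell h2 hρσ
  · have e1 := inner_part hρ h2.le le_rfl
    have e2 := shell (le_refl (r - 1)) h1.le
    linarith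

theorem radialIncr_cocoercive (hd : 0 < d) (hm : 0 < m) (hL : 0 < L) (hl : 0 < l) (hr : 0 < r)
    (hconv : StrongMonotone h m) (hlip : PolyLipschitz h L l)
    (hM : ∀ x y, ‖tamedDriftAt h m r x - tamedDriftAt h m r y‖ ≤ M * ‖x - y‖)
    {x y : E d} (hxy : ‖x‖ ≤ ‖y‖) :
    ‖radialIncr h m r x y‖ ^ 2 ≤ 2 * (M - m) * inner ℝ (radialIncr h m r x y) (x - y) :=
  radial_cocoercive hr tamingSup_nonneg (tamingSup_le hd hr hM)
    (fun _ _ hρ hρσ => tamingSup_mul_profile_le hd hm hr hconv hM hρ hρσ) hxy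
    (norm_cutT_smul_gDrift_le hlip hL hl hm hxy)

theorem nonneg_of_sq_le_mul {a c b : ℝ} (hc : 0 ≤ c) (hM : a ^ 2 ≤ c * b)
    (h0 : c = 0 → b = 0) : 0 ≤ b := by
  rcases hc.eq_or_lt with hc | hc
  · exact (h0 hc.symm).ge
  · exact nonneg_of_mul_nonneg_right ((sq_nonneg a).trans hM) hc

theorem inner_radialIncr_nonneg (hd : 0 < d) (hm : 0 < m) (hL : 0 < L) (hl : 0 < l) (hr : 0 < r)
    (hconv : StrongMonotone h m) (hlip : PolyLipschitz h L l)
    (hM : ∀ x y, ‖tamedDriftAt h m r x - tamedDriftAt h m r y‖ ≤ M * ‖x - y‖)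
    {x y : E d} (hxy : ‖x‖ ≤ ‖y‖) : 0 ≤ inner ℝ (radialIncr h m r x y) (x - y) := by
  have h1 := radialIncr_cocoercive hd hm hL hl hr hconv hlip hM hxy
  have h2 : 0 ≤ M - m := tamingSup_nonneg.trans (tamingSup_le hd hr hM)
  refine nonneg_of_sq_le_mul (by linarith) h1 fun h0 => ?_
  rw [h0, zero_mul] at h1
  have h3 : radialIncr h m r x y = 0 := by
    rw [← norm_eq_zero]
    exact pow_eq_zero_iff two_ne_zero |>.1 (le_antisymm h1 (sq_nonneg _))
  rw [h3, inner_zero_left]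

/-- The increment of the drift is tested against `a - b`. The radial part contributes a nonnegative
amount and can be dropped, and `t(σ) ≤ t(‖b‖)` replaces the cut-off by one that is uniform on the
ball. -/
theorem cutT_mul_inner_gDrift_le (hd : 0 < d) (hm : 0 < m) (hL : 0 < L) (hl : 0 < l) (hr : 0 < r)
    (hconv : StrongMonotone h m) (hlip : PolyLipschitz h L l)
    (hM : ∀ x y, ‖tamedDriftAt h m r x - tamedDriftAt h m r y‖ ≤ M * ‖x - y‖)
    {x y : E d} {σ : ℝ} (hx : ‖x‖ ≤ σ) (hy : ‖y‖ ≤ σ) :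
    cutT r σ * inner ℝ (gDrift h m x - gDrift h m y) (x - y) ≤ (M - m) * ‖x - y‖ ^ 2 := by
  have main : ∀ {a b : E d}, ‖a‖ ≤ ‖b‖ → ‖b‖ ≤ σ →
      cutT r σ * inner ℝ (gDrift h m a - gDrift h m b) (a - b) ≤ (M - m) * ‖a - b‖ ^ 2 := by
    intro a b hab hb
    have h1 := inner_tamedDriftAt_sub_le hM a b
    have h2 := inner_radialIncr_nonneg hd hm hL hl hr hconv hlip hM hab
    have h3 := gDrift_strongMonotone hconv a b
    have h4 : 0 ≤ m * ‖a - b‖ ^ 2 := by positivity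
    have h5 := mul_le_mul_of_nonneg_right (cutT_antitone (r := r) hb) (h4.trans h3)
    linarith
  rcases le_total ‖x‖ ‖y‖ with hxy | hxy
  · exact main hxy hy
  · have := main hxy hx
    rwa [norm_sub_rev, ← neg_sub (gDrift h m x), ← neg_sub x, inner_neg_neg] at this

/-- The only place where it matters that the untamed drift is a gradient. -/
theorem hasGradientAt_gDrift {u : E d → ℝ} (hu : Differentiable ℝ u) (z : E d) :
    HasGradientAt (fun x => u x - m / 2 * ‖x‖ ^ 2) (gDrift (gradient u) m z) z := by
  have h1 := (hu z).hasGradientAt.hasFDerivAt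
  have h2 := ((hasStrictFDerivAt_norm_sq z).hasFDerivAt).const_mul (m / 2)
  rw [hasGradientAt_iff_hasFDerivAt]
  refine (h1.sub h2).congr_fderiv ?_
  ext v
  simp [gDrift]
  ring

theorem cutT_smul_gDrift_cocoercive {u : E d → ℝ} (hu : Differentiable ℝ u)
    (hd : 0 < d) (hm : 0 < m) (hL : 0 < L) (hl : 0 < l) (hr : 0 < r)
    (hconv : StrongMonotone (gradient u) m) (hlip : PolyLipschitz (gradient u) L l)
    (hM : ∀ x y, ‖tamedDriftAt (gradient u) m r x - tamedDriftAt (gradient u) m r y‖ ≤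
      M * ‖x - y‖) {x y : E d} (hxy : ‖x‖ ≤ ‖y‖) :
    ‖cutT r ‖y‖ • (gDrift (gradient u) m x - gDrift (gradient u) m y)‖ ^ 2 ≤
      (M - m) * inner ℝ (cutT r ‖y‖ • (gDrift (gradient u) m x - gDrift (gradient u) m y))
        (x - y) := by
  set g := gDrift (gradient u) m with hg
  have hN : 0 ≤ M - m := tamingSup_nonneg.trans (tamingSup_le hd hr hM)
  have hI : 0 ≤ inner ℝ (g x - g y) (x - y) :=
    le_trans (by positivity) (gDrift_strongMonotone hconv x y)
  rw [norm_smul, Real.norm_eq_abs, abs_of_nonneg cutT_nonneg, real_inner_smul_left]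
  have hT0 : 0 ≤ cutT r ‖y‖ := cutT_nonneg
  suffices H : cutT r ‖y‖ * ‖g x - g y‖ ^ 2 ≤ (M - m) * inner ℝ (g x - g y) (x - y) by
    have := mul_le_mul_of_nonneg_left H hT0
    linarith
  rcases eq_or_ne x y with rfl | hne
  · simp
  have hpos : 0 < ‖x - y‖ := norm_pos_iff.2 (sub_ne_zero.2 hne)
  rcases le_or_gt r ‖y‖ with hy | hy
  · rw [cutT_eq_zero hy, zero_mul]; positivity
  -- Baillon-Haddad needs an open ball containing `y`, hence a radius `σ` slightly larger than
  -- `‖y‖`. It gives the constant `(M - m) / t(σ)`, and replacing `t(σ)` by `t(‖y‖)` costs at most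
  -- `(σ - ‖y‖) q ≤ ε`.
  apply le_of_forall_pos_le_add
  intro ε hε
  set q := ‖g x - g y‖ ^ 2 with hq
  have hq0 : 0 ≤ q := sq_nonneg _
  obtain ⟨σ, hσ1, hσ2, hσ3⟩ : ∃ σ, ‖y‖ < σ ∧ σ < r ∧ (σ - ‖y‖) * q ≤ ε := by
    refine ⟨‖y‖ + min ((r - ‖y‖) / 2) (ε / (q + 1)), ?_, ?_, ?_⟩
    · have : 0 < min ((r - ‖y‖) / 2) (ε / (q + 1)) :=
        lt_min (by linarith) (by positivity)
      linarith
    · have := min_le_left ((r - ‖y‖) / 2) (ε / (q + 1))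
      linarith
    · have h1 := min_le_right ((r - ‖y‖) / 2) (ε / (q + 1))
      rw [add_sub_cancel_left]
      calc min ((r - ‖y‖) / 2) (ε / (q + 1)) * q ≤ ε / (q + 1) * q := by gcongr
        _ ≤ ε / (q + 1) * (q + 1) := by gcongr; linarith
        _ = ε := by field_simp
  have hTσ : 0 < cutT r σ := by unfold cutT; split_ifs <;> linarith
  have hball : ∀ {z : E d}, z ∈ Metric.ball (0 : E d) σ → ‖z‖ ≤ σ := fun hz =>
    (mem_ball_zero_iff.1 hz).le
  have hNpos : 0 < M - m := by
    have h1 := cutT_mul_inner_gDrift_le hd hm hL hl hr hconv hlip hM (hxy.trans hσ1.le) hσ1.le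
    have h2 := gDrift_strongMonotone hconv x y
    have h3 : 0 < cutT r σ * (m * ‖x - y‖ ^ 2) := by positivity
    have h4 : 0 < (M - m) * ‖x - y‖ ^ 2 :=
      lt_of_lt_of_le h3 ((mul_le_mul_of_nonneg_left h2 hTσ.le).trans h1)
    exact (pos_iff_pos_of_mul_pos h4).2 (by positivity)
  have key := gradient_cocoercive_on_ball (σ := σ) (c := (M - m) / cutT r σ)
    (fun z _ => hasGradientAt_gDrift (m := m) hu z) (by positivity)
    (fun a ha b hb => gDrift_lipschitz_on_ball hlip hL hl hm ((hball ha).trans hσ2.le)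
      ((hball hb).trans hσ2.le))
    (fun a _ b _ => le_trans (by positivity) (gDrift_strongMonotone hconv a b))
    (fun a ha b hb => by
      rw [div_mul_eq_mul_div, le_div_iff₀ hTσ, mul_comm]
      exact cutT_mul_inner_gDrift_le hd hm hL hl hr hconv hlip hM (hball ha) (hball hb))
    (mem_ball_zero_iff.2 (hxy.trans_lt hσ1)) (mem_ball_zero_iff.2 hσ1)
  rw [div_mul_eq_mul_div, le_div_iff₀ hTσ] at key
  have h1 := cutT_sub_le (r := r) hσ1.le
  have h2 : (cutT r ‖y‖ - cutT r σ) * q ≤ (σ - ‖y‖) * q := by gcongr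
  linarith

/-- Cocoercivity of the tamed drift minus its strongly monotone part, although the tamed drift is
in general not a gradient. -/
theorem tamedDriftAt_cocoercive {u : E d → ℝ} (hu : Differentiable ℝ u)
    (hd : 0 < d) (hm : 0 < m) (hL : 0 < L) (hl : 0 < l) (hr : 0 < r)
    (hconv : StrongMonotone (gradient u) m) (hlip : PolyLipschitz (gradient u) L l)
    (hM : ∀ x y, ‖tamedDriftAt (gradient u) m r x - tamedDriftAt (gradient u) m r y‖ ≤
      M * ‖x - y‖) (x y : E d) :
    ‖tamedDriftAt (gradient u) m r x - tamedDriftAt (gradient u) m r y - m • (x - y)‖ ^ 2 ≤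
      3 * (M - m) * inner ℝ
        (tamedDriftAt (gradient u) m r x - tamedDriftAt (gradient u) m r y - m • (x - y))
        (x - y) := by
  have main : ∀ {a b : E d}, ‖a‖ ≤ ‖b‖ →
      ‖tamedDriftAt (gradient u) m r a - tamedDriftAt (gradient u) m r b - m • (a - b)‖ ^ 2 ≤
      3 * (M - m) * inner ℝ
        (tamedDriftAt (gradient u) m r a - tamedDriftAt (gradient u) m r b - m • (a - b))
        (a - b) := by
    intro a b hab
    have h1 := cutT_smul_gDrift_cocoercive hu hd hm hL hl hr hconv hlip hM hab
    have h2 := radialIncr_cocoercive hd hm hL hl hr hconv hlip hM hab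
    rw [tamedDriftAt_sub, add_sub_cancel_left]
    set p := cutT r ‖b‖ • (gDrift (gradient u) m a - gDrift (gradient u) m b)
    set q := radialIncr (gradient u) m r a b
    have h3 : ‖p + q‖ ≤ ‖p‖ + ‖q‖ := norm_add_le p q
    have h4 : ‖p + q‖ ^ 2 ≤ (‖p‖ + ‖q‖) ^ 2 := by gcongr
    rw [inner_add_left]
    -- `(‖p‖ + ‖q‖)² ≤ 3 ‖p‖² + (3 / 2) ‖q‖²`: these weights turn the constants `M - m` and `2 (M -
    -- m)` into the common value `3 (M - m)`.
    nlinarith [sq_nonneg (2 * ‖p‖ - ‖q‖)]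
  rcases le_total ‖x‖ ‖y‖ with hxy | hxy
  · exact main hxy
  · have := main hxy
    have e : tamedDriftAt (gradient u) m r y - tamedDriftAt (gradient u) m r x - m • (y - x) =
        -(tamedDriftAt (gradient u) m r x - tamedDriftAt (gradient u) m r y - m • (x - y)) := by
      module
    rwa [e, norm_neg, ← neg_sub x y, inner_neg_neg] at this

end Cocoercive

end Drift

/-! ### One-step contraction in units with `γ = 1` -/

section OneStep

/-- What is left of the step after division by `ε`. As `A ≥ 4`, the part `-A/2 + 2` is nonpositive,
so the form is at most `-(5/4) A² μ W² + (21/10) A μ X W - (3/2) μ X²`. The square of `X - (7/10) A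
W` absorbs the mixed term. -/
theorem quadratic_form_nonpos {A μ ε X W : ℝ} (hA : 4 ≤ A) (hμ : 0 < μ) (hAμ : A * μ ≤ 1)
    (hε : 0 < ε) (hεμ : 33 * ε ≤ μ) (hX : 0 ≤ X) (hW : 0 ≤ W) :
    W ^ 2 * (-(A / 2) + 2 - 3 / 2 * (A ^ 2 * μ) + A * μ / 3 + 2 * ε * A + 2 * ε) +
      (2 * A * μ + 2 * ε * μ + ε) * (X * W) +
      X ^ 2 * (-(5 / 3) * μ + ε * μ + ε ^ 2 * μ / 4 + ε ^ 2 / 16 + 3 * ε / 8) ≤ 0 := by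
  have hμ4 : μ ≤ 1 / 4 := by nlinarith
  have hε1 : ε ≤ 1 / 132 := by linarith
  have hx : -(5 / 3) * μ + ε * μ + ε ^ 2 * μ / 4 + ε ^ 2 / 16 + 3 * ε / 8 ≤ -(3 / 2) * μ := by
    nlinarith [mul_pos hε hμ, mul_pos hε hε]
  have hxw : 2 * A * μ + 2 * ε * μ + ε ≤ 21 / 10 * (A * μ) := by nlinarith [mul_pos hε hμ]
  have hAμ0 : 0 < A * μ := by positivity
  have e1 : 4 * (A * μ) ≤ A ^ 2 * μ := by nlinarith
  have e2 : 16 * μ ≤ A ^ 2 * μ := by nlinarith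
  have e3 : 33 * (ε * A) ≤ A * μ := by nlinarith
  have hw : -(A / 2) + 2 - 3 / 2 * (A ^ 2 * μ) + A * μ / 3 + 2 * ε * A + 2 * ε ≤
      -(5 / 4) * (A ^ 2 * μ) := by linarith
  have h1 := mul_le_mul_of_nonneg_left hx (sq_nonneg X)
  have h2 := mul_le_mul_of_nonneg_right hxw (mul_nonneg hX hW)
  have h3 := mul_le_mul_of_nonneg_left hw (sq_nonneg W)
  have h4 : 0 ≤ μ * (X - A * W * (7 / 10)) ^ 2 := by positivity
  have h5 : 0 ≤ A ^ 2 * μ * W ^ 2 := by positivity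
  nlinarith [mul_nonneg hμ.le (sq_nonneg X)]

/-- The last bound is the reason for `b = 1/γ`: the drift of `|x|²` contributes `ε η` and the
damping of `⟨x, v⟩` contributes `η² - 1 ≈ -ε`, so the mixed term survives only at order `ε²`. -/
theorem damping_bounds {ε η : ℝ} (hε : 0 < ε) (hε1 : ε ≤ 1) (h1 : 1 - ε / 2 ≤ η)
    (h2 : η ≤ 1 - ε / 2 + ε ^ 2 / 8) :
    0 < η ∧ η ≤ 1 ∧ η ^ 2 ≤ 1 - ε + ε ^ 2 / 2 ∧ η ^ 4 ≤ 1 - 2 * ε + 2 * ε ^ 2 ∧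
      |ε * η + η ^ 2 - 1| ≤ ε ^ 2 / 2 := by
  have h0 : 0 < η := by linarith
  have h3 : η ≤ 1 := by nlinarith
  have h4 : η ^ 2 ≤ (1 - ε / 2 + ε ^ 2 / 8) ^ 2 := by gcongr
  have hε3 : ε ^ 4 ≤ ε ^ 3 := pow_le_pow_of_le_one hε.le hε1 (by norm_num)
  have hε2 : ε ^ 3 ≤ ε ^ 2 := pow_le_pow_of_le_one hε.le hε1 (by norm_num)
  have hp3 : 0 < ε ^ 3 := by positivity
  have h5 : η ^ 2 ≤ 1 - ε + ε ^ 2 / 2 := by nlinarith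
  have h6 : (η ^ 2) ^ 2 ≤ (1 - ε + ε ^ 2 / 2) ^ 2 := by gcongr
  refine ⟨h0, h3, h5, by nlinarith, ?_⟩
  have h7 : (1 - ε / 2) ^ 2 ≤ η ^ 2 := by
    have : 0 ≤ 1 - ε / 2 := by linarith
    gcongr
  rw [abs_le]
  constructor <;> nlinarith

/-- The left side is the expanded norm after one step. With `F = P - μ x` and `G = Q - μ y`, the
dissipations `D₀ = ⟨F, x⟩` and `D₁ = ⟨G, y⟩` enter with weight `-ε η` and cancel the same quantities
in the bounds `hwF`, `hwG`. Those bounds leave `(3/2) ε A (1 - A μ) W²`, against `-2 ε A W²` from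
the friction. All other terms are of higher order in `ε` or go into `quadratic_form_nonpos`. -/
theorem obabo_scalar_bound {A μ ε η X W Y p xw wP wF wG D₀ D₁ S : ℝ} (hA : 4 ≤ A) (hμ : 0 < μ)
    (hAμ : A * μ ≤ 1) (hε : 0 < ε) (hεμ : 33 * ε ≤ μ) (h1 : 1 - ε / 2 ≤ η)
    (h2 : η ≤ 1 - ε / 2 + ε ^ 2 / 8) (hX : 0 ≤ X) (hW : 0 ≤ W) (hp0 : 0 ≤ p)
    (hp : 4 * p ≤ X) (hxw : |xw| ≤ X * W) (hwP : |wP| ≤ W * p) (hD₀ : 0 ≤ D₀)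
    (hwF : |A * wF| ≤ 3 / 4 * (A * (1 - A * μ)) * W ^ 2 + D₀)
    (hwG : |A * wG| ≤ 3 / 4 * (A * (1 - A * μ)) * W ^ 2 + D₁)
    (hYl : X ^ 2 - 2 * ε * (X * W) - ε ^ 2 * X ^ 2 / 4 ≤ Y ^ 2)
    (hYu : Y ^ 2 ≤ 2 * X ^ 2 + 2 * W ^ 2) (hS : S ≤ (X ^ 2 + Y ^ 2) / 2) :
    (X ^ 2 + 2 * (ε * η) * xw - ε ^ 2 * (D₀ + μ * X ^ 2) + ε ^ 2 * η ^ 2 * W ^ 2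
      - ε ^ 3 * η * wP + ε ^ 4 / 4 * p ^ 2)
    + 2 * η ^ 2 * (xw + ε * η * W ^ 2 - ε ^ 2 / 2 * wP)
    - ε * η * (D₀ + μ * X ^ 2 + ε * η * wP - ε ^ 2 / 2 * p ^ 2) - ε * η * (D₁ + μ * Y ^ 2)
    + A * η ^ 4 * W ^ 2
    - A * ε * η ^ 3 * (wF + wG + μ * xw + μ * (xw + ε * η * W ^ 2 - ε ^ 2 / 2 * wP))
    + ε ^ 2 * η ^ 2 / 4 * S
    ≤ (1 - ε * μ / 3) * (X ^ 2 + 2 * xw + A * W ^ 2) := by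
  have hμ4 : μ ≤ 1 / 4 := by nlinarith
  have hε1 : ε ≤ 1 / 132 := by linarith
  obtain ⟨hη0, hη1, hη2, hη4, hc⟩ := damping_bounds hε (by linarith) h1 h2
  have hη21 : η ^ 2 ≤ 1 := pow_le_one₀ hη0.le hη1
  have hη31 : η ^ 3 ≤ 1 := pow_le_one₀ hη0.le hη1
  have hXW : 0 ≤ X * W := mul_nonneg hX hW
  have hA0 : 0 < A := by linarith
  -- the velocity terms
  have tW : A * η ^ 4 * W ^ 2 ≤ A * (1 - 2 * ε + 2 * ε ^ 2) * W ^ 2 := by gcongr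
  have tW2 : ε ^ 2 * η ^ 2 * W ^ 2 ≤ ε ^ 2 * W ^ 2 := by
    have := mul_le_mul_of_nonneg_right hη21 (by positivity : 0 ≤ ε ^ 2 * W ^ 2)
    linarith
  have tW3 : η ^ 3 * (ε * W ^ 2) ≤ ε * W ^ 2 := mul_le_of_le_one_left (by positivity) hη31
  have tW4 : 0 ≤ A * ε * η ^ 3 * μ * (ε * η * W ^ 2) := by positivity
  -- the cross terms with the cocoercive part
  have cross : ∀ {q D : ℝ}, |A * q| ≤ 3 / 4 * (A * (1 - A * μ)) * W ^ 2 + D →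
      -(A * ε * η ^ 3 * q) ≤ ε * η * D + ε * (3 / 4 * (A * (1 - A * μ)) * W ^ 2) := by
    intro q D hq
    have hS0 : 0 ≤ 3 / 4 * (A * (1 - A * μ)) * W ^ 2 := by
      have : 0 ≤ 1 - A * μ := by linarith
      positivity
    have hq1 : -(A * q) ≤ |A * q| := neg_le_abs _
    have hq2 : η ^ 3 * -(A * q) ≤ η ^ 3 * |A * q| := by gcongr
    have hq3 : η ^ 3 * |A * q| ≤ η * |A * q| := by
      gcongr
      calc η ^ 3 = η * η ^ 2 := by ring
        _ ≤ η := mul_le_of_le_one_right hη0.le hη21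
    have hq4 : η * |A * q| ≤ η * (3 / 4 * (A * (1 - A * μ)) * W ^ 2 + D) := by gcongr
    have hq5 : η * (3 / 4 * (A * (1 - A * μ)) * W ^ 2) ≤ 3 / 4 * (A * (1 - A * μ)) * W ^ 2 :=
      mul_le_of_le_one_left hS0 hη1
    have hq6 : η ^ 3 * -(A * q) ≤ η * D + 3 / 4 * (A * (1 - A * μ)) * W ^ 2 := by linarith
    have hq7 := mul_le_mul_of_nonneg_left hq6 hε.le
    linarith
  have tF := cross hwF
  have tG := cross hwG
  -- the position-velocity terms
  have txw : (2 * (ε * η + η ^ 2 - 1) - 2 * (A * ε * η ^ 3 * μ) + 2 * (ε * μ / 3)) * xw ≤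
      2 * A * μ * ε * (X * W) := by
    have h3 : |2 * (ε * η + η ^ 2 - 1) - 2 * (A * ε * η ^ 3 * μ) + 2 * (ε * μ / 3)| ≤
        2 * A * μ * ε := by
      have hc' := abs_le.1 hc
      have h5 : A * ε * η ^ 3 * μ ≤ A * ε * μ := by
        have := mul_le_mul_of_nonneg_left hη31 (by positivity : 0 ≤ A * ε * μ)
        linarith
      have h6 : 0 ≤ A * ε * η ^ 3 * μ := by positivity
      have h7 : 4 * (ε * μ) ≤ A * (ε * μ) := by gcongr
      have h8 : ε * (33 * ε) ≤ ε * μ := by gcongr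
      rw [abs_le]
      have h9 := mul_pos hε hμ
      constructor <;> linarith only [hc', h5, h6, h7, h8, h9]
    calc _ ≤ |(2 * (ε * η + η ^ 2 - 1) - 2 * (A * ε * η ^ 3 * μ) + 2 * (ε * μ / 3)) * xw| :=
          le_abs_self _
      _ ≤ 2 * A * μ * ε * (X * W) := by
        rw [abs_mul]
        exact mul_le_mul h3 hxw (abs_nonneg _) (by positivity)
  -- the remaining terms
  have twP : (-(ε ^ 3 * η) - 2 * (ε ^ 2 * η ^ 2) + A * ε * η ^ 3 * μ * (ε ^ 2 / 2)) * wP ≤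
      ε ^ 2 * (X * W) := by
    have h3 : |-(ε ^ 3 * η) - 2 * (ε ^ 2 * η ^ 2) + A * ε * η ^ 3 * μ * (ε ^ 2 / 2)| ≤
        4 * ε ^ 2 := by
      have h4 : A * μ * η ^ 3 ≤ 1 := mul_le_one₀ hAμ (by positivity) hη31
      have h4' : ε ^ 3 * (A * μ * η ^ 3) ≤ ε ^ 3 * 1 := by gcongr
      have h5 : ε ^ 3 ≤ ε ^ 2 := pow_le_pow_of_le_one hε.le (by linarith) (by norm_num)
      have h6 : ε ^ 3 * η ≤ ε ^ 3 * 1 := by gcongr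
      have h7 : ε ^ 2 * η ^ 2 ≤ ε ^ 2 * 1 := by gcongr
      have h8 : 0 ≤ ε ^ 3 * η := by positivity
      have h9 : 0 ≤ ε ^ 2 * η ^ 2 := by positivity
      have h10 : 0 ≤ ε ^ 3 * (A * μ * η ^ 3) := by positivity
      rw [abs_le]
      constructor <;> linarith only [h4', h5, h6, h7, h8, h9, h10]
    calc _ ≤ |(-(ε ^ 3 * η) - 2 * (ε ^ 2 * η ^ 2) + A * ε * η ^ 3 * μ * (ε ^ 2 / 2)) * wP| :=
          le_abs_self _
      _ ≤ 4 * ε ^ 2 * (W * p) := by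
        rw [abs_mul]
        exact mul_le_mul h3 hwP (abs_nonneg _) (by positivity)
      _ ≤ ε ^ 2 * (X * W) := by
        have := mul_le_mul_of_nonneg_left hp (by positivity : 0 ≤ ε ^ 2 * W)
        linarith
  have tp : (ε ^ 4 / 4 + ε ^ 3 * η / 2) * p ^ 2 ≤ ε ^ 3 * X ^ 2 / 16 := by
    have h3 : p ^ 2 ≤ X ^ 2 / 16 := by nlinarith
    have h4 : ε ^ 4 ≤ ε ^ 3 := pow_le_pow_of_le_one hε.le (by linarith) (by norm_num)
    have h5 : ε ^ 3 * η ≤ ε ^ 3 * 1 := by gcongr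
    have h6 : 0 < ε ^ 3 := by positivity
    have h7 : ε ^ 4 / 4 + ε ^ 3 * η / 2 ≤ ε ^ 3 := by linarith
    calc _ ≤ ε ^ 3 * (X ^ 2 / 16) := by gcongr
      _ = _ := by ring
  have tS : ε ^ 2 * η ^ 2 / 4 * S ≤ ε ^ 2 * (3 * X ^ 2 + 2 * W ^ 2) / 8 := by
    have h3 : ε ^ 2 * η ^ 2 / 4 * S ≤ ε ^ 2 * η ^ 2 / 4 * ((3 * X ^ 2 + 2 * W ^ 2) / 2) := by
      gcongr; linarith only [hS, hYu]
    have h4 : η ^ 2 * (ε ^ 2 * (3 * X ^ 2 + 2 * W ^ 2)) ≤ ε ^ 2 * (3 * X ^ 2 + 2 * W ^ 2) :=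
      mul_le_of_le_one_left (by positivity) hη21
    linarith only [h3, h4]
  have tX : -(ε * η * (μ * X ^ 2)) ≤ -(ε * μ * X ^ 2) + ε ^ 2 * μ * X ^ 2 / 2 := by
    have := mul_le_mul_of_nonneg_left h1 (by positivity : 0 ≤ ε * (μ * X ^ 2))
    linarith only [this]
  have tY : -(ε * η * (μ * Y ^ 2)) ≤ -(ε * μ * X ^ 2) + ε ^ 2 * μ * X ^ 2 / 2 +
      ε * μ * (2 * ε * (X * W) + ε ^ 2 * X ^ 2 / 4) := by
    have h3 := mul_le_mul_of_nonneg_left hYl (by positivity : 0 ≤ ε * η * μ)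
    have h4 : η * (ε * μ * (2 * ε * (X * W) + ε ^ 2 * X ^ 2 / 4)) ≤
        ε * μ * (2 * ε * (X * W) + ε ^ 2 * X ^ 2 / 4) :=
      mul_le_of_le_one_left (by positivity) hη1
    linarith only [h3, h4, tX]
  have tD : 0 ≤ ε ^ 2 * (D₀ + μ * X ^ 2) := by positivity
  have key := mul_le_mul_of_nonneg_left
    (quadratic_form_nonpos hA hμ hAμ hε hεμ hX hW) hε.le
  have hε2W : 0 ≤ ε ^ 2 * W ^ 2 := by positivity
  linarith only [key, hε2W, tW, tW2, tW3, tW4, tF, tG, txw, twP, tp, tS, tX, tY, tD]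

variable {V : Type*} [NormedAddCommGroup V] [InnerProductSpace ℝ V]

/-- Cauchy-Schwarz and cocoercivity give `(A ⟨w, F⟩)² ≤ 4 · (3/4) A c ‖w‖² · ⟨F, x⟩`, and `4 α β ≤
(α + β)²`. The split gives `⟨F, x⟩` the coefficient 1, which the dissipation can match. -/
theorem abs_inner_le_of_cocoercive {A c : ℝ} (hA : 0 ≤ A) (hc : 0 ≤ c) {w F x : V}
    (hD : 0 ≤ inner ℝ F x) (hF : A * ‖F‖ ^ 2 ≤ 3 * c * inner ℝ F x) :
    |A * inner ℝ w F| ≤ 3 / 4 * (A * c) * ‖w‖ ^ 2 + inner ℝ F x := by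
  apply abs_le_of_sq_le_sq _ (by positivity)
  have h1 : (inner ℝ w F) ^ 2 ≤ (‖w‖ * ‖F‖) ^ 2 :=
    sq_le_sq.2 ((abs_real_inner_le_norm w F).trans (le_abs_self _))
  have h2 := mul_le_mul_of_nonneg_left h1 (sq_nonneg A)
  have h3 := mul_le_mul_of_nonneg_left hF (by positivity : 0 ≤ A * ‖w‖ ^ 2)
  nlinarith [sq_nonneg (3 / 4 * (A * c) * ‖w‖ ^ 2 - inner ℝ F x)]

theorem inner_nonneg_of_cocoercive {A c : ℝ} (hA : 0 < A) (hc : 0 ≤ c) {F x : V}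
    (hF : A * ‖F‖ ^ 2 ≤ 3 * c * inner ℝ F x) : 0 ≤ inner ℝ F x := by
  rcases hc.eq_or_lt with rfl | hc
  · have h1 : A * ‖F‖ ^ 2 = 0 := le_antisymm (by linarith) (by positivity)
    have h2 : F = 0 := by simpa [hA.ne'] using h1
    simp [h2]
  · by_contra! h
    have : 0 ≤ A * ‖F‖ ^ 2 := by positivity
    nlinarith [mul_neg_of_pos_of_neg hc h]

theorem sq_le_of_le_combination {X W Y : ℝ} (hY : 0 ≤ Y) (h : Y ≤ 9 / 8 * X + 1 / 8 * W) :
    Y ^ 2 ≤ 2 * X ^ 2 + 2 * W ^ 2 := by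
  have h5 : Y ^ 2 ≤ (9 / 8 * X + 1 / 8 * W) ^ 2 := by gcongr
  nlinarith [sq_nonneg (X - W), sq_nonneg X, sq_nonneg W]

theorem mul_sq_le_of_mul_le {A p q : ℝ} (hA : 4 ≤ A) (hp : 0 ≤ p) (h : A * p ≤ q) :
    A * p ^ 2 ≤ q ^ 2 / 4 := by
  have h1 : 4 * p ≤ q := (mul_le_mul_of_nonneg_right hA hp).trans h
  have h2 : A * p * p ≤ q * (q / 4) := mul_le_mul h (by linarith) hp (by linarith)
  linarith

/-- One-step contraction of the synchronously coupled OBABO scheme, in units with `γ = 1`. -/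
theorem obabo_contraction_normalized {A μ ε η : ℝ} (hA : 4 ≤ A) (hμ : 0 < μ)
    (hAμ : A * μ ≤ 1) (hε : 0 < ε) (hεμ : 33 * ε ≤ μ) (h1 : 1 - ε / 2 ≤ η)
    (h2 : η ≤ 1 - ε / 2 + ε ^ 2 / 8) {x w P Q y w₁ : V}
    (hP : A * ‖P‖ ≤ ‖x‖) (hQ : A * ‖Q‖ ≤ ‖y‖)
    (hPc : A * ‖P - μ • x‖ ^ 2 ≤ 3 * (1 - A * μ) * inner ℝ (P - μ • x) x)
    (hQc : A * ‖Q - μ • y‖ ^ 2 ≤ 3 * (1 - A * μ) * inner ℝ (Q - μ • y) y)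
    (hy : y = x + (ε * η) • w - (ε ^ 2 / 2) • P)
    (hw₁ : w₁ = η ^ 2 • w - (ε * η / 2) • (P + Q)) :
    ‖y‖ ^ 2 + 2 * inner ℝ y w₁ + A * ‖w₁‖ ^ 2 ≤
      (1 - ε * μ / 3) * (‖x‖ ^ 2 + 2 * inner ℝ x w + A * ‖w‖ ^ 2) := by
  have hA0 : 0 < A := by linarith
  have hc0 : 0 ≤ 1 - A * μ := by linarith
  have hμ4 : μ ≤ 1 / 4 := by nlinarith
  have hε1 : ε ≤ 1 / 132 := by linarith
  obtain ⟨hη0, hη1, -, -, -⟩ := damping_bounds hε (by linarith) h1 h2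
  have hD₀ := inner_nonneg_of_cocoercive hA0 hc0 hPc
  have hD₁ := inner_nonneg_of_cocoercive hA0 hc0 hQc
  have hwF := abs_inner_le_of_cocoercive (w := w) hA0.le hc0 hD₀ hPc
  have hwG := abs_inner_le_of_cocoercive (w := w) hA0.le hc0 hD₁ hQc
  have hp4 : 4 * ‖P‖ ≤ ‖x‖ := (mul_le_mul_of_nonneg_right hA (norm_nonneg P)).trans hP
  have hxw := abs_real_inner_le_norm x w
  have hwP := abs_real_inner_le_norm w P
  have hxP := abs_real_inner_le_norm x P
  have hyy : ‖y‖ ^ 2 = ‖x‖ ^ 2 + 2 * (ε * η) * inner ℝ x w - ε ^ 2 * inner ℝ x P +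
      ε ^ 2 * η ^ 2 * ‖w‖ ^ 2 - ε ^ 3 * η * inner ℝ w P + ε ^ 4 / 4 * ‖P‖ ^ 2 := by
    rw [hy, @norm_sub_sq_real, @norm_add_sq_real, inner_add_left]
    simp only [real_inner_smul_left, real_inner_smul_right, norm_smul, Real.norm_eq_abs, mul_pow,
      sq_abs]
    ring
  have hyw : inner ℝ w y = inner ℝ x w + ε * η * ‖w‖ ^ 2 - ε ^ 2 / 2 * inner ℝ w P := by
    rw [hy, inner_sub_right, inner_add_right, real_inner_smul_right, real_inner_smul_right,
      real_inner_self_eq_norm_sq, real_inner_comm]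
  have hyP : inner ℝ y P = inner ℝ x P + ε * η * inner ℝ w P - ε ^ 2 / 2 * ‖P‖ ^ 2 := by
    rw [hy, inner_sub_left, inner_add_left, real_inner_smul_left, real_inner_smul_left,
      real_inner_self_eq_norm_sq]
  have hxP' : inner ℝ x P = inner ℝ (P - μ • x) x + μ * ‖x‖ ^ 2 := by
    rw [inner_sub_left, real_inner_smul_left, real_inner_self_eq_norm_sq, real_inner_comm]; ring
  have hyQ : inner ℝ y Q = inner ℝ (Q - μ • y) y + μ * ‖y‖ ^ 2 := by
    rw [inner_sub_left, real_inner_smul_left, real_inner_self_eq_norm_sq, real_inner_comm]; ring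
  have hwPQ : inner ℝ w (P + Q) = inner ℝ w (P - μ • x) + inner ℝ w (Q - μ • y) +
      μ * inner ℝ x w + μ * inner ℝ w y := by
    rw [inner_sub_right, inner_sub_right, inner_add_right, real_inner_smul_right,
      real_inner_smul_right, real_inner_comm x w]; ring
  have hyw₁ : inner ℝ y w₁ = η ^ 2 * inner ℝ w y - ε * η / 2 * (inner ℝ y P + inner ℝ y Q) := by
    rw [hw₁, inner_sub_right, real_inner_smul_right, real_inner_smul_right, inner_add_right,
      real_inner_comm]
  have hw₁w₁ : ‖w₁‖ ^ 2 = η ^ 4 * ‖w‖ ^ 2 - ε * η ^ 3 * inner ℝ w (P + Q) +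
      ε ^ 2 * η ^ 2 / 4 * ‖P + Q‖ ^ 2 := by
    rw [hw₁, @norm_sub_sq_real]
    simp only [real_inner_smul_left, real_inner_smul_right, norm_smul, Real.norm_eq_abs, mul_pow,
      sq_abs]
    ring
  have hYn : ‖y‖ ≤ ‖x‖ + ε * ‖w‖ + ε ^ 2 / 8 * ‖x‖ := by
    rw [hy]
    refine (norm_sub_le _ _).trans ?_
    have h3 := norm_add_le x ((ε * η) • w)
    have h4 : ‖(ε * η) • w‖ ≤ ε * ‖w‖ := by
      rw [norm_smul, Real.norm_eq_abs, abs_of_pos (by positivity)]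
      gcongr
      exact mul_le_of_le_one_right hε.le hη1
    have h5 : ‖(ε ^ 2 / 2) • P‖ ≤ ε ^ 2 / 8 * ‖x‖ := by
      rw [norm_smul, Real.norm_eq_abs, abs_of_pos (by positivity)]
      have := mul_le_mul_of_nonneg_left hp4 (by positivity : 0 ≤ ε ^ 2 / 8)
      linarith
    linarith
  have hYu : ‖y‖ ^ 2 ≤ 2 * ‖x‖ ^ 2 + 2 * ‖w‖ ^ 2 := by
    have h3 : ε ^ 2 / 8 ≤ 1 / 8 := by
      have : ε ^ 2 ≤ 1 := pow_le_one₀ hε.le (by linarith)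
      linarith
    have h4 : ‖y‖ ≤ 9 / 8 * ‖x‖ + 1 / 8 * ‖w‖ := by
      have := mul_le_mul_of_nonneg_right h3 (norm_nonneg x)
      have := mul_le_mul_of_nonneg_right (by linarith : ε ≤ 1 / 8) (norm_nonneg w)
      linarith
    exact sq_le_of_le_combination (norm_nonneg y) h4
  -- The square of the displacement `y - x` is dropped, which leaves `‖x‖²` and the inner products
  -- of `x` with the displacement.
  have hYl : ‖x‖ ^ 2 - 2 * ε * (‖x‖ * ‖w‖) - ε ^ 2 * ‖x‖ ^ 2 / 4 ≤ ‖y‖ ^ 2 := by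
    have h3 : ‖(ε * η) • w - (ε ^ 2 / 2) • P‖ ^ 2 + 2 * (ε * η) * inner ℝ x w -
        ε ^ 2 * inner ℝ x P + ‖x‖ ^ 2 = ‖y‖ ^ 2 := by
      rw [hyy, @norm_sub_sq_real]
      simp only [real_inner_smul_left, real_inner_smul_right, norm_smul, Real.norm_eq_abs,
        mul_pow, sq_abs]
      ring
    have h4 : ε * η * -inner ℝ x w ≤ ε * (‖x‖ * ‖w‖) := by
      have h5 := (neg_le_abs (inner ℝ x w)).trans hxw
      have h6 : ε * η * -inner ℝ x w ≤ ε * η * (‖x‖ * ‖w‖) := by gcongr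
      have h7 : η * (ε * (‖x‖ * ‖w‖)) ≤ ε * (‖x‖ * ‖w‖) :=
        mul_le_of_le_one_left (by positivity) hη1
      linarith
    have h5 : ε ^ 2 * inner ℝ x P ≤ ε ^ 2 * (‖x‖ * (‖x‖ / 4)) := by
      gcongr
      refine (le_abs_self _).trans (hxP.trans ?_)
      gcongr
      linarith
    linarith only [sq_nonneg ‖(ε * η) • w - (ε ^ 2 / 2) • P‖, h3, h4, h5]
  have hS : A * ‖P + Q‖ ^ 2 ≤ (‖x‖ ^ 2 + ‖y‖ ^ 2) / 2 := by
    have h3 : ‖P + Q‖ ^ 2 ≤ (‖P‖ + ‖Q‖) ^ 2 := by gcongr; exact norm_add_le _ _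
    have h4 : (‖P‖ + ‖Q‖) ^ 2 ≤ 2 * (‖P‖ ^ 2 + ‖Q‖ ^ 2) := add_sq_le
    have h5 := mul_sq_le_of_mul_le hA (norm_nonneg P) hP
    have h6 := mul_sq_le_of_mul_le hA (norm_nonneg Q) hQ
    have h7 := mul_le_mul_of_nonneg_left (h3.trans h4) hA0.le
    linarith only [h5, h6, h7]
  have key := obabo_scalar_bound hA hμ hAμ hε hεμ h1 h2 (norm_nonneg x) (norm_nonneg w)
    (norm_nonneg P) hp4 hxw hwP hD₀ hwF hwG hYl hYu hS
  rw [← hxP', ← hyw, ← hyP, ← hyQ] at key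
  rw [← hyy] at key
  rw [hyw₁, hw₁w₁, hwPQ]
  linarith only [key]

end OneStep

/-! ### Contraction in the weighted norm, in the original units -/

section Contraction

theorem exp_neg_le_quadratic {t : ℝ} (ht : 0 ≤ t) : Real.exp (-t) ≤ 1 - t + t ^ 2 / 2 := by
  have h1 := Real.quadratic_le_exp_of_nonneg ht
  have h2 : Real.exp (-t) * Real.exp t = 1 := by rw [← Real.exp_add]; simp
  have h3 : 0 < 1 - t + t ^ 2 / 2 := by nlinarith [sq_nonneg (t - 1)]
  -- `(1 - t + t²/2) (1 + t + t²/2) = 1 + t⁴/4`.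
  have h4 : 1 ≤ (1 - t + t ^ 2 / 2) * Real.exp t := by
    have := mul_le_mul_of_nonneg_left h1 h3.le
    nlinarith [sq_nonneg (t ^ 2)]
  exact le_of_mul_le_mul_right (h2.trans_le h4) (Real.exp_pos t)

variable {d : ℕ}

theorem sq_le_of_two_sqrt_le {M γ : ℝ} (hM : 0 ≤ M) (hγM : 2 * √M ≤ γ) : 4 * M ≤ γ ^ 2 := by
  have h1 : (2 * √M) ^ 2 ≤ γ ^ 2 := by gcongr
  rw [mul_pow, Real.sq_sqrt hM] at h1
  linarith

/-- `4 M ≤ γ²` makes the mixed term at most half of the diagonal part. The factors 1/2 and 3/2 are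
the source of `2 M` and `3/2` in the comparison with the Euclidean norm for `M ≥ 1`, and so of the
prefactor `3 M`. -/
theorem quadratic_form_bounds {M γ : ℝ} (hM : 0 < M) (hγ : 0 < γ) (hγM : 2 * √M ≤ γ)
    (z : Phase d) :
    (‖z.1‖ ^ 2 + 1 / M * ‖z.2‖ ^ 2) / 2 ≤
        ‖z.1‖ ^ 2 + 2 * (1 / γ) * inner ℝ z.1 z.2 + 1 / M * ‖z.2‖ ^ 2 ∧
      ‖z.1‖ ^ 2 + 2 * (1 / γ) * inner ℝ z.1 z.2 + 1 / M * ‖z.2‖ ^ 2 ≤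
        3 / 2 * (‖z.1‖ ^ 2 + 1 / M * ‖z.2‖ ^ 2) := by
  have h1 : 2 * (1 / γ) * (‖z.1‖ * ‖z.2‖) ≤ (‖z.1‖ ^ 2 + 1 / M * ‖z.2‖ ^ 2) / 2 := by
    have h2 : 4 * (1 / γ) ^ 2 ≤ 1 / M := by
      rw [one_div_pow, ← mul_div_assoc, mul_one, div_le_div_iff₀ (by positivity) hM]
      linarith [sq_le_of_two_sqrt_le hM.le hγM]
    have h3 := mul_le_mul_of_nonneg_right h2 (sq_nonneg ‖z.2‖)
    linarith [sq_nonneg (‖z.1‖ - 2 * (1 / γ) * ‖z.2‖)]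
  have h2 := abs_le.1 (abs_real_inner_le_norm z.1 z.2)
  have h3 : 0 < 2 * (1 / γ) := by positivity
  have h4 := mul_le_mul_of_nonneg_left h2.1 h3.le
  have h5 := mul_le_mul_of_nonneg_left h2.2 h3.le
  constructor <;> linarith

theorem weightedNorm_sq {M γ : ℝ} (hM : 0 < M) (hγ : 0 < γ) (hγM : 2 * √M ≤ γ) (z : Phase d) :
    weightedNorm (1 / M) (1 / γ) z ^ 2 =
      ‖z.1‖ ^ 2 + 2 * (1 / γ) * inner ℝ z.1 z.2 + 1 / M * ‖z.2‖ ^ 2 :=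
  Real.sq_sqrt (le_trans (by positivity) (quadratic_form_bounds hM hγ hγM z).1)

theorem weightedNorm_sq_eq {A M γ : ℝ} (hM : 0 < M) (hγ : 0 < γ) (hγM : 2 * √M ≤ γ)
    (hA : A = γ ^ 2 / M) (z : Phase d) :
    weightedNorm (1 / M) (1 / γ) z ^ 2 =
      ‖z.1‖ ^ 2 + 2 * inner ℝ z.1 (γ⁻¹ • z.2) + A * ‖γ⁻¹ • z.2‖ ^ 2 := by
  rw [weightedNorm_sq hM hγ hγM, norm_smul, real_inner_smul_right, mul_pow, Real.norm_eq_abs,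
    sq_abs, hA]
  field_simp

theorem weightedNorm_le_euclNorm {M γ : ℝ} (hM : 1 ≤ M) (hγ : 0 < γ) (hγM : 2 * √M ≤ γ)
    (z : Phase d) : weightedNorm (1 / M) (1 / γ) z ^ 2 ≤ 3 / 2 * euclNorm z ^ 2 := by
  rw [weightedNorm_sq (by linarith) hγ hγM, euclNorm, Real.sq_sqrt (by positivity)]
  refine (quadratic_form_bounds (by linarith) hγ hγM z).2.trans ?_
  have : 1 / M * ‖z.2‖ ^ 2 ≤ 1 * ‖z.2‖ ^ 2 := by
    gcongr
    exact (div_le_one (by linarith)).2 hM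
  linarith

theorem euclNorm_le_weightedNorm {M γ : ℝ} (hM : 1 ≤ M) (hγ : 0 < γ) (hγM : 2 * √M ≤ γ)
    (z : Phase d) : euclNorm z ^ 2 ≤ 2 * M * weightedNorm (1 / M) (1 / γ) z ^ 2 := by
  have hM0 : 0 < M := by linarith
  rw [weightedNorm_sq hM0 hγ hγM, euclNorm, Real.sq_sqrt (by positivity)]
  have h1 := mul_le_mul_of_nonneg_left (quadratic_form_bounds hM0 hγ hγM z).1
    (by positivity : 0 ≤ 2 * M)
  have h2 : 2 * M * ((‖z.1‖ ^ 2 + 1 / M * ‖z.2‖ ^ 2) / 2) = M * ‖z.1‖ ^ 2 + ‖z.2‖ ^ 2 := by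
    field_simp
  have h3 := mul_le_mul_of_nonneg_right hM (sq_nonneg ‖z.1‖)
  linarith

/-- The synchronously coupled OBABO step with a drift `f` such that `f - m` is cocoercive
contracts the weighted norm. -/
theorem weightedNorm_obaboStep_sub_le {f : E d → E d} {m M lam γ : ℝ} (hm : 0 < m) (hmM : m ≤ M)
    (hlam : 0 < lam) (hγ : 0 < γ) (hγM : 2 * √M ≤ γ) (hlamγ : lam ≤ m / (33 * γ ^ 3))
    (hf : ∀ x y, ‖f x - f y‖ ≤ M * ‖x - y‖)
    (hfc : ∀ x y, ‖f x - f y - m • (x - y)‖ ^ 2 ≤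
      3 * (M - m) * inner ℝ (f x - f y - m • (x - y)) (x - y)) (z z' : Phase d) (G : E d × E d) :
    weightedNorm (1 / M) (1 / γ) (obaboStep f lam γ (z, G) - obaboStep f lam γ (z', G)) ^ 2 ≤
      (1 - lam * (m / (3 * γ))) * weightedNorm (1 / M) (1 / γ) (z - z') ^ 2 := by
  have hM : 0 < M := hm.trans_le hmM
  have hγ4 := sq_le_of_two_sqrt_le hM.le hγM
  have hA : 4 ≤ γ ^ 2 / M := by rw [le_div_iff₀ hM]; linarith
  have hAμ : γ ^ 2 / M * (m / γ ^ 2) = m / M := by field_simp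
  have hε : 0 < lam * γ := by positivity
  have hεμ : 33 * (lam * γ) ≤ m / γ ^ 2 := by
    rw [le_div_iff₀ (by positivity)] at hlamγ ⊢
    linarith
  have hη1 : 1 - lam * γ / 2 ≤ eta lam γ := by
    have := Real.add_one_le_exp (-(lam * γ) / 2)
    unfold eta; linarith
  have hη2 : eta lam γ ≤ 1 - lam * γ / 2 + (lam * γ) ^ 2 / 8 := by
    have := exp_neg_le_quadratic (by positivity : 0 ≤ lam * γ / 2)
    unfold eta; rw [neg_div]; linarith
  have cocoercive : ∀ p q : E d, γ ^ 2 / M *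
      ‖(γ ^ 2)⁻¹ • (f p - f q) - (m / γ ^ 2) • (p - q)‖ ^ 2 ≤
      3 * (1 - γ ^ 2 / M * (m / γ ^ 2)) *
        inner ℝ ((γ ^ 2)⁻¹ • (f p - f q) - (m / γ ^ 2) • (p - q)) (p - q) := by
    intro p q
    have e : (γ ^ 2)⁻¹ • (f p - f q) - (m / γ ^ 2) • (p - q) =
        (γ ^ 2)⁻¹ • (f p - f q - m • (p - q)) := by
      rw [div_eq_inv_mul]
      module
    rw [e, norm_smul, mul_pow, real_inner_smul_left, Real.norm_eq_abs, sq_abs, hAμ]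
    have h1 := mul_le_mul_of_nonneg_left (hfc p q)
      (by positivity : 0 ≤ γ ^ 2 / M * ((γ ^ 2)⁻¹) ^ 2)
    refine (le_of_eq_of_le (by ring) h1).trans_eq ?_
    field_simp
  have lipschitz : ∀ p q : E d, γ ^ 2 / M * ‖(γ ^ 2)⁻¹ • (f p - f q)‖ ≤ ‖p - q‖ := by
    intro p q
    rw [norm_smul, Real.norm_eq_abs, abs_of_pos (by positivity)]
    have h1 := mul_le_mul_of_nonneg_left (hf p q) (by positivity : 0 ≤ γ ^ 2 / M * (γ ^ 2)⁻¹)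
    refine (le_of_eq_of_le (by ring) h1).trans_eq ?_
    field_simp
  rw [weightedNorm_sq_eq hM hγ hγM rfl, weightedNorm_sq_eq hM hγ hγM rfl]
  -- Dictionary: `ε = λ γ`, `μ = m / γ²`, `A = γ² / M`, velocities are divided by `γ` and drifts by
  -- `γ²`. The common noise `G` cancels in the differences.
  have key := obabo_contraction_normalized (η := eta lam γ) hA (by positivity : 0 < m / γ ^ 2)
    (by rw [hAμ]; exact (div_le_one hM).2 hmM) hε hεμ hη1 hη2
    (x := z.1 - z'.1) (w := γ⁻¹ • (z.2 - z'.2)) (P := (γ ^ 2)⁻¹ • (f z.1 - f z'.1))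
    (y := obaboPos f lam γ z.1 z.2 G.1 - obaboPos f lam γ z'.1 z'.2 G.1)
    (Q := (γ ^ 2)⁻¹ • (f (obaboPos f lam γ z.1 z.2 G.1) - f (obaboPos f lam γ z'.1 z'.2 G.1)))
    (w₁ := γ⁻¹ • ((obaboStep f lam γ (z, G)).2 - (obaboStep f lam γ (z', G)).2))
    (lipschitz _ _) (lipschitz _ _) (cocoercive _ _) (cocoercive _ _)
    (by
      have e1 : lam * γ * eta lam γ * γ⁻¹ = lam * eta lam γ := by field_simp
      have e2 : (lam * γ) ^ 2 / 2 * (γ ^ 2)⁻¹ = lam ^ 2 / 2 := by field_simp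
      rw [smul_smul, smul_smul, e1, e2]
      unfold obaboPos
      module)
    (by
      have e1 : lam * γ * eta lam γ / 2 * (γ ^ 2)⁻¹ = γ⁻¹ * (lam * eta lam γ / 2) := by
        field_simp
      rw [← smul_add, smul_smul (lam * γ * eta lam γ / 2), e1]
      simp only [obaboStep]
      module)
  refine le_of_le_of_eq key ?_
  have e : lam * γ * (m / γ ^ 2) / 3 = lam * (m / (3 * γ)) := by field_simp
  rw [e]
  rfl

end Contraction

/-! ### Laws of the chain as push-forwards -/

section Kernel

variable {d : ℕ} {f : E d → E d} {lam γ : ℝ}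

/-- The law of the pair of Gaussian inputs of one step. -/
noncomputable abbrev noise (d : ℕ) : Measure (E d × E d) :=
  (stdGaussian (E d)).prod (stdGaussian (E d))

theorem bind_obaboKernel (hf : Measurable f) (ν : Measure (Phase d)) :
    ν.bind (obaboKernel f lam γ) = (ν.prod (noise d)).map (obaboStep f lam γ) := by
  have hs := measurable_obaboStep hf lam γ
  ext s hs'
  rw [Measure.bind_apply hs' (obaboKernel f lam γ).measurable.aemeasurable,
    Measure.map_apply hs hs', Measure.prod_apply (hs hs')]
  refine lintegral_congr fun z => ?_
  have hz : Measurable fun G => obaboStep f lam γ (z, G) := hs.comp measurable_prodMk_left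
  rw [obaboKernel_apply hf, Measure.map_apply hz hs']
  rfl

theorem isProbabilityMeasure_bind (hf : Measurable f) (ν : Measure (Phase d))
    [IsProbabilityMeasure ν] : IsProbabilityMeasure (ν.bind (obaboKernel f lam γ)) := by
  rw [bind_obaboKernel hf]
  exact Measure.isProbabilityMeasure_map (measurable_obaboStep hf lam γ).aemeasurable

theorem lawAfter_succ (P : Kernel (Phase d) (Phase d)) (n : ℕ) (ν : Measure (Phase d)) :
    lawAfter P (n + 1) ν = (lawAfter P n ν).bind P :=
  Function.iterate_succ_apply' _ _ _

theorem lawAfter_succ' (P : Kernel (Phase d) (Phase d)) (n : ℕ) (ν : Measure (Phase d)) :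
    lawAfter P (n + 1) ν = lawAfter P n (ν.bind P) :=
  Function.iterate_succ_apply _ _ _

theorem isProbabilityMeasure_lawAfter (hf : Measurable f) (n : ℕ) (ν : Measure (Phase d))
    [IsProbabilityMeasure ν] : IsProbabilityMeasure (lawAfter (obaboKernel f lam γ) n ν) := by
  induction n with
  | zero => assumption
  | succ n ih => rw [lawAfter_succ]; exact isProbabilityMeasure_bind hf _

theorem lawAfter_of_invariant {P : Kernel (Phase d) (Phase d)} {ν : Measure (Phase d)}
    (h : P.Invariant ν) (n : ℕ) : lawAfter P n ν = ν := by
  induction n with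
  | zero => rfl
  | succ n ih => rw [lawAfter_succ, ih]; exact h

end Kernel

/-! ### Wasserstein contraction -/

section Wasserstein

variable {d : ℕ} {f : E d → E d} {lam γ : ℝ}

theorem ofReal_rpow_le_of_le_mul {a b k p : ℝ} (hk : 0 ≤ k) (hp : 0 ≤ p) (h : a ≤ k * b) :
    ENNReal.ofReal a ^ p ≤ ENNReal.ofReal k ^ p * ENNReal.ofReal b ^ p := by
  rw [← ENNReal.mul_rpow_of_nonneg _ _ hp, ← ENNReal.ofReal_mul hk]
  exact ENNReal.rpow_le_rpow (ENNReal.ofReal_le_ofReal h) hp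

/-- Comparison of infima: couplings are transformed one at a time, so no optimal coupling is needed.
The conditions on `k` allow it to pass through the infimum in `ℝ≥0∞`. -/
theorem iInf_rpow_le {N N' : Phase d → ℝ} {p : ℝ} (hp : 1 ≤ p) {k : ℝ≥0∞}
    (hk0 : k ≠ 0) (hk : k ≠ ⊤)
    {μ ν μ' ν' : Measure (Phase d)}
    (H : ∀ ρ ∈ couplings μ ν, ∃ ρ' ∈ couplings μ' ν',
      ∫⁻ w, ENNReal.ofReal (N' (w.1 - w.2)) ^ p ∂ρ' ≤
        k ^ p * ∫⁻ w, ENNReal.ofReal (N (w.1 - w.2)) ^ p ∂ρ) :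
    wass N' p μ' ν' ≤ k * wass N p μ ν := by
  have hp0 : 0 < p := by linarith
  unfold wass
  rw [← ENNReal.rpow_rpow_inv hp0.ne' k, ← one_div,
    ← ENNReal.mul_rpow_of_nonneg _ _ (by positivity)]
  refine ENNReal.rpow_le_rpow ?_ (by positivity)
  have hkp0 : k ^ p ≠ 0 := by simp [hk0, hk]
  have hkp : k ^ p ≠ ⊤ := ENNReal.rpow_ne_top_of_nonneg hp0.le hk
  rw [ENNReal.mul_iInf_of_ne hkp0 hkp]
  refine le_iInf fun ρ => ?_
  rw [ENNReal.mul_iInf_of_ne hkp0 hkp]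
  refine le_iInf fun hρ => ?_
  obtain ⟨ρ', hρ', hle⟩ := H ρ hρ
  exact (iInf₂_le ρ' hρ').trans hle

theorem wass_le_of_norm_le {N N' : Phase d → ℝ} {p k : ℝ} (hp : 1 ≤ p) (hk : 0 < k)
    (h : ∀ z, N' z ≤ k * N z) (μ ν : Measure (Phase d)) :
    wass N' p μ ν ≤ ENNReal.ofReal k * wass N p μ ν := by
  refine iInf_rpow_le hp (by simpa using hk) ENNReal.ofReal_ne_top fun ρ hρ => ⟨ρ, hρ, ?_⟩
  rw [← lintegral_const_mul' _ _ (ENNReal.rpow_ne_top_of_nonneg (by linarith) ENNReal.ofReal_ne_top)]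
  exact lintegral_mono fun w => ofReal_rpow_le_of_le_mul hk.le (by linarith) (h _)

/-- Synchronous coupling: both components of a coupling are moved with the same independent noise.
Its marginals are the laws after one step, and the cost shrinks pointwise. -/
theorem wass_bind_le (hf : Measurable f) {N : Phase d → ℝ} (hN : Measurable N) {p q : ℝ}
    (hp : 1 ≤ p) (hq : 0 < q)
    (h : ∀ z z' G, N (obaboStep f lam γ (z, G) - obaboStep f lam γ (z', G)) ≤ q * N (z - z'))
    (μ ν : Measure (Phase d)) [IsProbabilityMeasure μ] :
    wass N p (μ.bind (obaboKernel f lam γ)) (ν.bind (obaboKernel f lam γ)) ≤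
      ENNReal.ofReal q * wass N p μ ν := by
  have hs := measurable_obaboStep hf lam γ
  refine iInf_rpow_le hp (by simpa using hq) ENNReal.ofReal_ne_top fun ρ hρ => ?_
  obtain ⟨hρ1, hρ2⟩ := hρ
  have : IsProbabilityMeasure ρ := by
    have : IsProbabilityMeasure (ρ.map Prod.fst) := by rw [hρ1]; infer_instance
    exact Measure.isProbabilityMeasure_of_map Prod.fst
  have hT : Measurable fun w : (Phase d × Phase d) × (E d × E d) =>
      (obaboStep f lam γ (w.1.1, w.2), obaboStep f lam γ (w.1.2, w.2)) := by fun_prop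
  refine ⟨(ρ.prod (noise d)).map fun w =>
    (obaboStep f lam γ (w.1.1, w.2), obaboStep f lam γ (w.1.2, w.2)), ⟨?_, ?_⟩, ?_⟩
  · rw [bind_obaboKernel hf, Measure.map_map measurable_fst hT, ← hρ1,
      ← Measure.map_id (μ := noise d), Measure.map_prod_map _ _ measurable_fst measurable_id,
      Measure.map_map hs (by fun_prop), Measure.map_id]
    rfl
  · rw [bind_obaboKernel hf, Measure.map_map measurable_snd hT, ← hρ2,
      ← Measure.map_id (μ := noise d), Measure.map_prod_map _ _ measurable_snd measurable_id,
      Measure.map_map hs (by fun_prop), Measure.map_id]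
    rfl
  · rw [lintegral_map (by fun_prop) hT]
    calc _ ≤ ∫⁻ w : (Phase d × Phase d) × (E d × E d), ENNReal.ofReal q ^ p *
          ENNReal.ofReal (N (w.1.1 - w.1.2)) ^ p ∂(ρ.prod (noise d)) :=
        lintegral_mono fun w => ofReal_rpow_le_of_le_mul hq.le (by linarith) (h _ _ _)
      _ = ENNReal.ofReal q ^ p * ∫⁻ w : (Phase d × Phase d) × (E d × E d),
          ENNReal.ofReal (N (w.1.1 - w.1.2)) ^ p ∂(ρ.prod (noise d)) :=
        lintegral_const_mul' _ _
          (ENNReal.rpow_ne_top_of_nonneg (by linarith) ENNReal.ofReal_ne_top)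
      _ = _ := by
        congr 1
        have := (measurePreserving_fst (μ := ρ) (ν := noise d)).lintegral_comp
          (f := fun w => ENNReal.ofReal (N (w.1 - w.2)) ^ p) (by fun_prop)
        exact this

theorem wass_lawAfter_le (hf : Measurable f) {N : Phase d → ℝ} (hN : Measurable N) {p q : ℝ}
    (hp : 1 ≤ p) (hq : 0 < q)
    (h : ∀ z z' G, N (obaboStep f lam γ (z, G) - obaboStep f lam γ (z', G)) ≤ q * N (z - z'))
    (μ ν : Measure (Phase d)) [IsProbabilityMeasure μ] (n : ℕ) :
    wass N p (lawAfter (obaboKernel f lam γ) n μ) (lawAfter (obaboKernel f lam γ) n ν) ≤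
      ENNReal.ofReal (q ^ n) * wass N p μ ν := by
  induction n with
  | zero => simp [lawAfter]
  | succ n ih =>
    have := isProbabilityMeasure_lawAfter (lam := lam) (γ := γ) hf n μ
    rw [lawAfter_succ, lawAfter_succ]
    refine (wass_bind_le hf hN hp hq h _ _).trans ?_
    rw [pow_succ', ENNReal.ofReal_mul hq.le, mul_assoc]
    gcongr

end Wasserstein

/-! ### Merging of laws on bounded Lipschitz functions, and uniqueness -/

section TestFunctions

variable {d : ℕ} {f : E d → E d} {lam γ : ℝ}

/-- Indicators of closed sets are limits of thickened indicators, which are bounded and Lipschitz,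
and closed sets form a π-system generating the Borel sets. -/
theorem measure_eq_of_forall_integral_lipschitz_eq {μ ν : Measure (Phase d)}
    [IsProbabilityMeasure μ] [IsProbabilityMeasure ν]
    (H : ∀ (g : Phase d → ℝ) (B K : ℝ), (∀ z, |g z| ≤ B) → (∀ z z', |g z - g z'| ≤ K * ‖z - z'‖) →
      ∫ z, g z ∂μ = ∫ z, g z ∂ν) : μ = ν := by
  refine ext_of_generate_finite {s | IsClosed s} ?_ isPiSystem_isClosed (fun F hF => ?_) (by simp)
  · rw [← borel_eq_generateFrom_isClosed]; exact BorelSpace.measurable_eq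
  have hδ : ∀ n : ℕ, 0 < 1 / ((n : ℝ) + 1) := fun n => by positivity
  have h1 := tendsto_lintegral_thickenedIndicator_of_isClosed μ hF hδ
    tendsto_one_div_add_atTop_nhds_zero_nat
  have h2 := tendsto_lintegral_thickenedIndicator_of_isClosed ν hF hδ
    tendsto_one_div_add_atTop_nhds_zero_nat
  refine tendsto_nhds_unique h1 (h2.congr fun n => ?_)
  have hint : ∀ (ρ : Measure (Phase d)) [IsProbabilityMeasure ρ],
      ∫⁻ z, (thickenedIndicator (hδ n) F z : ℝ≥0∞) ∂ρ =
        ENNReal.ofReal (∫ z, (thickenedIndicator (hδ n) F z : ℝ) ∂ρ) := by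
    intro ρ _
    apply lintegral_coe_eq_integral
    refine Integrable.of_bound (C := 1)
      (by fun_prop) (ae_of_all _ fun z => ?_)
    rw [Real.norm_eq_abs, abs_of_nonneg (NNReal.coe_nonneg _)]
    exact_mod_cast thickenedIndicator_le_one (hδ n) F z
  rw [hint, hint]
  congr 1
  refine (H _ 1 ((1 / ((n : ℝ) + 1)).toNNReal⁻¹ : ℝ≥0) (fun z => ?_) fun z z' => ?_).symm
  · rw [abs_of_nonneg (NNReal.coe_nonneg _)]
    exact_mod_cast thickenedIndicator_le_one (hδ n) F z
  · have := (lipschitzWith_thickenedIndicator (hδ n) F).dist_le_mul z z'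
    rwa [NNReal.dist_eq, dist_eq_norm] at this

theorem integral_bind_obaboKernel (hf : Measurable f) {g : Phase d → ℝ} (hg : Continuous g) {B : ℝ}
    (hB : ∀ z, |g z| ≤ B) (ν : Measure (Phase d)) [IsProbabilityMeasure ν] :
    ∫ z, g z ∂(ν.bind (obaboKernel f lam γ)) =
      ∫ z, ∫ G, g (obaboStep f lam γ (z, G)) ∂(noise d) ∂ν := by
  have hs := measurable_obaboStep hf lam γ
  rw [bind_obaboKernel hf, integral_map hs.aemeasurable hg.aestronglyMeasurable, integral_prod]
  exact Integrable.of_bound (C := B) (hg.measurable.comp hs).aestronglyMeasurable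
    (ae_of_all _ fun z => hB _)

theorem continuous_of_abs_sub_le {N : Phase d → ℝ} {C K : ℝ} (hup : ∀ z, N z ≤ C * ‖z‖)
    (hK : 0 ≤ K) {g : Phase d → ℝ} (hg : ∀ z z', |g z - g z'| ≤ K * N (z - z')) :
    Continuous g := by
  refine (LipschitzWith.of_dist_le' (K := K * C) fun z z' => ?_).continuous
  rw [Real.dist_eq, dist_eq_norm, mul_assoc]
  exact (hg z z').trans (mul_le_mul_of_nonneg_left (hup _) hK)

/-- The dual action of the chain on bounded Lipschitz functions. -/
theorem exists_integral_lawAfter_eq (hf : Measurable f) {N : Phase d → ℝ} {C q : ℝ}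
    (hup : ∀ z, N z ≤ C * ‖z‖) (hq : 0 ≤ q)
    (h : ∀ z z' G, N (obaboStep f lam γ (z, G) - obaboStep f lam γ (z', G)) ≤ q * N (z - z'))
    {g : Phase d → ℝ} {B K : ℝ} (hK : 0 ≤ K) (hB : ∀ z, |g z| ≤ B)
    (hg : ∀ z z', |g z - g z'| ≤ K * N (z - z')) (n : ℕ) :
    ∃ g' : Phase d → ℝ, (∀ z, |g' z| ≤ B) ∧ (∀ z z', |g' z - g' z'| ≤ K * q ^ n * N (z - z')) ∧
      ∀ ν : Measure (Phase d), IsProbabilityMeasure ν →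
        ∫ z, g z ∂(lawAfter (obaboKernel f lam γ) n ν) = ∫ z, g' z ∂ν := by
  induction n with
  | zero => exact ⟨g, hB, by simpa using hg, fun ν _ => rfl⟩
  | succ n ih =>
    obtain ⟨g₁, hB₁, hg₁, hint⟩ := ih
    have hcont := continuous_of_abs_sub_le hup (by positivity) hg₁
    have hs := measurable_obaboStep hf lam γ
    have hi : ∀ z, Integrable (fun G => g₁ (obaboStep f lam γ (z, G))) (noise d) := fun z =>
      Integrable.of_bound (C := B)
        (hcont.measurable.comp (hs.comp measurable_prodMk_left)).aestronglyMeasurable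
        (ae_of_all _ fun G => hB₁ _)
    refine ⟨fun z => ∫ G, g₁ (obaboStep f lam γ (z, G)) ∂(noise d), fun z => ?_, fun z z' => ?_,
      fun ν hν => ?_⟩
    · have := norm_integral_le_of_norm_le_const (μ := noise d) (C := B)
        (f := fun G => g₁ (obaboStep f lam γ (z, G))) (ae_of_all _ fun G => hB₁ _)
      simpa using this
    · rw [← integral_sub (hi z) (hi z')]
      have := norm_integral_le_of_norm_le_const (μ := noise d) (C := K * q ^ (n + 1) * N (z - z'))
        (f := fun G => g₁ (obaboStep f lam γ (z, G)) - g₁ (obaboStep f lam γ (z', G)))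
        (ae_of_all _ fun G => by
          rw [Real.norm_eq_abs]
          refine (hg₁ _ _).trans ?_
          have := mul_le_mul_of_nonneg_left (h z z' G) (by positivity : 0 ≤ K * q ^ n)
          rw [pow_succ]
          linarith)
      simpa using this
    · have := isProbabilityMeasure_bind (lam := lam) (γ := γ) hf ν
      rw [lawAfter_succ', hint _ this, integral_bind_obaboKernel hf hcont hB₁]

/-- The laws of two copies of the chain merge, whatever the initial laws. -/
theorem tendsto_integral_lawAfter_sub (hf : Measurable f) {N : Phase d → ℝ} {C q : ℝ}
    (hup : ∀ z, N z ≤ C * ‖z‖) (hq : 0 ≤ q) (hq1 : q < 1)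
    (h : ∀ z z' G, N (obaboStep f lam γ (z, G) - obaboStep f lam γ (z', G)) ≤ q * N (z - z'))
    {g : Phase d → ℝ} {B K : ℝ} (hK : 0 ≤ K) (hB : ∀ z, |g z| ≤ B)
    (hg : ∀ z z', |g z - g z'| ≤ K * N (z - z')) (μ ν : Measure (Phase d))
    [IsProbabilityMeasure μ] [IsProbabilityMeasure ν] :
    Filter.Tendsto (fun n => ∫ z, g z ∂(lawAfter (obaboKernel f lam γ) n μ) -
      ∫ z, g z ∂(lawAfter (obaboKernel f lam γ) n ν)) Filter.atTop (nhds 0) := by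
  choose g' hB' hg' hint using exists_integral_lawAfter_eq hf hup hq h hK hB hg
  have hcont : ∀ n, Continuous (g' n) := fun n =>
    continuous_of_abs_sub_le hup (by positivity) (hg' n)
  have hi : ∀ n (ρ : Measure (Phase d)) [IsProbabilityMeasure ρ], Integrable (g' n) ρ :=
    fun n ρ _ => Integrable.of_bound (C := B) (hcont n).aestronglyMeasurable
      (ae_of_all _ fun z => hB' n z)
  -- The iterated test function has Lipschitz constant `K q ^ n`, so its increments tend to 0
  -- pointwise while staying bounded by `2 B`. Dominated convergence under the product law then
  -- requires no moments.
  have hlim : Filter.Tendsto (fun n => ∫ w : Phase d × Phase d, (g' n w.1 - g' n w.2)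
      ∂(μ.prod ν)) Filter.atTop (nhds (∫ _ : Phase d × Phase d, (0 : ℝ) ∂(μ.prod ν))) := by
    refine tendsto_integral_of_dominated_convergence (fun _ => B + B) (fun n => ?_)
      (integrable_const _) (fun n => ae_of_all _ fun w => ?_) (ae_of_all _ fun w => ?_)
    · have := hcont n
      exact Continuous.aestronglyMeasurable (by fun_prop)
    · exact (norm_sub_le _ _).trans (add_le_add (hB' n _) (hB' n _))
    · refine squeeze_zero_norm (fun n => hg' n w.1 w.2) ?_
      have := ((tendsto_pow_atTop_nhds_zero_of_lt_one hq hq1).const_mul K).mul_const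
        (N (w.1 - w.2))
      simpa using this
  rw [integral_zero] at hlim
  refine hlim.congr fun n => ?_
  rw [hint n μ inferInstance, hint n ν inferInstance, integral_sub ((hi n μ).comp_fst ν)
    ((hi n ν).comp_snd μ), integral_fun_fst, integral_fun_snd]
  simp

theorem invariant_unique (hf : Measurable f) {N : Phase d → ℝ} {C C' q : ℝ}
    (hup : ∀ z, N z ≤ C * ‖z‖) (hC' : 0 ≤ C') (hlow : ∀ z, ‖z‖ ≤ C' * N z) (hq : 0 ≤ q)
    (hq1 : q < 1)
    (h : ∀ z z' G, N (obaboStep f lam γ (z, G) - obaboStep f lam γ (z', G)) ≤ q * N (z - z'))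
    {μ ν : Measure (Phase d)} [IsProbabilityMeasure μ] [IsProbabilityMeasure ν]
    (hμ : (obaboKernel f lam γ).Invariant μ) (hν : (obaboKernel f lam γ).Invariant ν) :
    μ = ν := by
  refine measure_eq_of_forall_integral_lipschitz_eq fun g B K hB hg => ?_
  have h1 := tendsto_integral_lawAfter_sub hf hup hq hq1 h (K := |K| * C') (by positivity) hB
    (fun z z' => by
      refine (hg z z').trans ?_
      rw [mul_assoc]
      exact mul_le_mul (le_abs_self K) (hlow _) (norm_nonneg _) (abs_nonneg _)) μ ν
  simp only [lawAfter_of_invariant hμ, lawAfter_of_invariant hν] at h1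
  exact sub_eq_zero.1 (tendsto_nhds_unique tendsto_const_nhds h1)

end TestFunctions

/-! ### Existence of an invariant law and its moments -/

section Existence

variable {d : ℕ} {f : E d → E d} {lam γ : ℝ}

theorem memLp_obaboStep_zero (hf : Continuous f) {a M : ℝ} (hfM : ∀ x, ‖f x‖ ≤ a + M * ‖x‖)
    (p : ℝ≥0∞) (hp : p ≠ ⊤) :
    MemLp (fun G => obaboStep f lam γ (0, G)) p (noise d) := by
  have h1 : MemLp (fun G : E d × E d => G.1) p (noise d) :=
    (IsGaussian.memLp_id (stdGaussian (E d)) p hp).comp_fst _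
  have h2 : MemLp (fun G : E d × E d => G.2) p (noise d) :=
    (IsGaussian.memLp_id (stdGaussian (E d)) p hp).comp_snd _
  have hx : MemLp (fun G : E d × E d => obaboPos f lam γ 0 0 G.1) p (noise d) := by
    have h3 : MemLp (fun _ : E d × E d => -((lam ^ 2 / 2) • f 0)) p (noise d) := memLp_const _
    refine ((h1.const_smul (lam * √(1 - eta lam γ ^ 2))).add h3).ae_eq (ae_of_all _ fun G => ?_)
    simp only [obaboPos, Pi.add_apply, Pi.smul_apply]
    module
  have hfx : MemLp (fun G : E d × E d => f (obaboPos f lam γ 0 0 G.1)) p (noise d) := by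
    have h3 : MemLp (fun G : E d × E d => a + M * ‖obaboPos f lam γ 0 0 G.1‖) p (noise d) :=
      (memLp_const a).add (hx.norm.const_mul M)
    refine h3.mono (hf.comp_aestronglyMeasurable hx.1) (ae_of_all _ fun G => ?_)
    exact (hfM _).trans (le_abs_self _)
  have hv : MemLp (fun G : E d × E d => (obaboStep f lam γ (0, G)).2) p (noise d) := by
    have h3 : MemLp (fun _ : E d × E d => -((lam * eta lam γ / 2) • f 0)) p (noise d) :=
      memLp_const _
    refine (((h3.add (hfx.const_smul (-(lam * eta lam γ / 2)))).add
      (h1.const_smul (√(1 - eta lam γ ^ 2) * eta lam γ))).add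
      (h2.const_smul √(1 - eta lam γ ^ 2))).ae_eq (ae_of_all _ fun G => ?_)
    simp only [obaboStep, Pi.add_apply, Pi.smul_apply, Prod.fst_zero, Prod.snd_zero]
    module
  have hs := measurable_obaboStep hf.measurable lam γ
  refine (hx.norm.add hv.norm).mono
    (hs.comp measurable_prodMk_left).aestronglyMeasurable (ae_of_all _ fun G => ?_)
  refine le_trans ?_ (le_abs_self _)
  refine max_le ?_ ?_
  · exact le_add_of_nonneg_right (norm_nonneg _)
  · exact le_add_of_nonneg_left (norm_nonneg _)

/-- Comparing a step from `z` with the step from 0 under the same noise gives `N (step z) ≤ q N z +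
N (step 0)`; Minkowski's inequality does the rest. -/
theorem eLpNorm_bind_le (hf : Measurable f) {N : Phase d → ℝ} {q : ℝ} (hN : Continuous N)
    (hN0 : ∀ z, 0 ≤ N z) (htri : ∀ z z', N z ≤ N (z - z') + N z') (hq : 0 ≤ q)
    (h : ∀ z z' G, N (obaboStep f lam γ (z, G) - obaboStep f lam γ (z', G)) ≤ q * N (z - z'))
    {p : ℝ≥0∞} (hp : 1 ≤ p) (ν : Measure (Phase d)) [IsProbabilityMeasure ν] :
    eLpNorm N p (ν.bind (obaboKernel f lam γ)) ≤ ENNReal.ofReal q * eLpNorm N p ν +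
      eLpNorm (fun G => N (obaboStep f lam γ (0, G))) p (noise d) := by
  have hs := measurable_obaboStep hf lam γ
  have hs0 : Measurable fun G => obaboStep f lam γ (0, G) := hs.comp measurable_prodMk_left
  rw [bind_obaboKernel hf, eLpNorm_map_measure hN.aestronglyMeasurable hs.aemeasurable]
  have h1 : eLpNorm (fun w : Phase d × (E d × E d) => N w.1) p (ν.prod (noise d)) =
      eLpNorm N p ν :=
    eLpNorm_comp_measurePreserving hN.aestronglyMeasurable measurePreserving_fst
  have h2 : eLpNorm (fun w : Phase d × (E d × E d) => N (obaboStep f lam γ (0, w.2))) p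
      (ν.prod (noise d)) = eLpNorm (fun G => N (obaboStep f lam γ (0, G))) p (noise d) :=
    eLpNorm_comp_measurePreserving (g := fun G => N (obaboStep f lam γ (0, G)))
      (hN.measurable.comp hs0).aestronglyMeasurable measurePreserving_snd
  have h3 : eLpNorm (fun w : Phase d × (E d × E d) => q * N w.1) p (ν.prod (noise d)) =
      ENNReal.ofReal q * eLpNorm N p ν := by
    rw [← h1, ← Real.enorm_of_nonneg hq]
    exact eLpNorm_const_smul q (fun w : Phase d × (E d × E d) => N w.1) p _
  rw [← h2, ← h3]
  refine le_trans (eLpNorm_mono_real (g := fun w : Phase d × (E d × E d) =>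
    q * N w.1 + N (obaboStep f lam γ (0, w.2))) fun w => ?_) (eLpNorm_add_le ?_ ?_ hp)
  · rw [Function.comp_apply, Real.norm_eq_abs, abs_of_nonneg (hN0 _)]
    have h4 := htri (obaboStep f lam γ w) (obaboStep f lam γ (0, w.2))
    have h5 := h w.1 0 w.2
    rw [sub_zero] at h5
    exact h4.trans (by gcongr)
  · exact (by fun_prop : Measurable fun w : Phase d × (E d × E d) =>
      q * N w.1).aestronglyMeasurable
  · exact ((hN.measurable.comp hs0).comp measurable_snd).aestronglyMeasurable

theorem exists_eLpNorm_lawAfter_le (hf : Continuous f) {a M : ℝ} (hfM : ∀ x, ‖f x‖ ≤ a + M * ‖x‖)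
    {N : Phase d → ℝ} {C q : ℝ} (hN : Continuous N)
    (hN0 : ∀ z, 0 ≤ N z) (htri : ∀ z z', N z ≤ N (z - z') + N z')
    (hup : ∀ z, N z ≤ C * ‖z‖) (hq : 0 ≤ q) (hq1 : q < 1)
    (h : ∀ z z' G, N (obaboStep f lam γ (z, G) - obaboStep f lam γ (z', G)) ≤ q * N (z - z'))
    {p : ℝ≥0∞} (hp : 1 ≤ p) (hp' : p ≠ ⊤) :
    ∃ b : ℝ≥0, ∀ n, eLpNorm N p (lawAfter (obaboKernel f lam γ) n (Measure.dirac 0)) ≤ b := by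
  have hfin : eLpNorm (fun G => N (obaboStep f lam γ (0, G))) p (noise d) ≠ ⊤ := by
    have h1 : MemLp (fun G => N (obaboStep f lam γ (0, G))) p (noise d) :=
      (memLp_obaboStep_zero hf hfM p hp').of_le_mul (c := C)
        (hN.measurable.comp ((measurable_obaboStep hf.measurable lam γ).comp
          measurable_prodMk_left)).aestronglyMeasurable
        (ae_of_all _ fun G => by
          rw [Real.norm_eq_abs, abs_of_nonneg (hN0 _)]
          exact hup _)
    exact h1.2.ne
  set β := (eLpNorm (fun G => N (obaboStep f lam γ (0, G))) p (noise d)).toReal with hβ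
  have hβ0 : 0 ≤ β := ENNReal.toReal_nonneg
  have hq1' : 0 < 1 - q := by linarith
  -- The fixed point of the recursion `b ↦ q b + β`, which starts from 0 at the Dirac mass.
  refine ⟨(β / (1 - q)).toNNReal, fun n => ?_⟩
  change _ ≤ ENNReal.ofReal (β / (1 - q))
  induction n with
  | zero =>
    have h1 : eLpNorm N p (Measure.dirac (0 : Phase d)) = 0 := by
      have h2 : N =ᵐ[Measure.dirac (0 : Phase d)] 0 := by
        rw [Filter.EventuallyEq, ae_dirac_eq]
        have := hup 0
        rw [norm_zero, mul_zero] at this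
        exact le_antisymm this (hN0 0)
      rw [eLpNorm_congr_ae h2, eLpNorm_zero]
    exact h1.trans_le bot_le
  | succ n ih =>
    have := isProbabilityMeasure_lawAfter (lam := lam) (γ := γ) hf.measurable n
      (Measure.dirac (0 : Phase d))
    rw [lawAfter_succ]
    refine (eLpNorm_bind_le hf.measurable hN hN0 htri hq h hp _).trans ?_
    rw [← ENNReal.ofReal_toReal hfin, ← hβ]
    calc _ ≤ ENNReal.ofReal q * ENNReal.ofReal (β / (1 - q)) + ENNReal.ofReal β := by gcongr
      _ = ENNReal.ofReal (β / (1 - q)) := by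
        rw [← ENNReal.ofReal_mul hq, ← ENNReal.ofReal_add (by positivity) hβ0]
        congr 1
        field_simp
        ring

/-- Moment bounds survive weak limits: the truncations `min φ n` are bounded and continuous, and
monotone convergence removes the truncation. -/
theorem lintegral_le_of_tendsto {ι : Type*} {F : Filter ι} [F.NeBot]
    {μs : ι → ProbabilityMeasure (Phase d)} {μ : ProbabilityMeasure (Phase d)}
    (hμ : Filter.Tendsto μs F (nhds μ)) {φ : Phase d → ℝ≥0} (hφ : Continuous φ) {b : ℝ≥0∞}
    (hb : ∀ i, ∫⁻ z, φ z ∂(μs i : Measure (Phase d)) ≤ b) :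
    ∫⁻ z, φ z ∂(μ : Measure (Phase d)) ≤ b := by
  have hsup : ∀ z, (φ z : ℝ≥0∞) = ⨆ n : ℕ, ((min (φ z) n : ℝ≥0) : ℝ≥0∞) := by
    intro z
    refine le_antisymm ?_ (iSup_le fun n => by exact_mod_cast min_le_left _ _)
    obtain ⟨n, hn⟩ := exists_nat_ge (φ z)
    refine le_iSup_of_le n ?_
    rw [min_eq_left hn]
  simp_rw [hsup]
  rw [lintegral_iSup (fun n => by fun_prop) fun i j hij z => by
    have : (i : ℝ≥0) ≤ j := by exact_mod_cast hij
    exact ENNReal.coe_le_coe.2 (min_le_min le_rfl this)]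
  refine iSup_le fun n => ?_
  let g : BoundedContinuousFunction (Phase d) ℝ≥0 :=
    BoundedContinuousFunction.mkOfBound ⟨fun z => min (φ z) n, by fun_prop⟩ n fun z z' => by
      rw [NNReal.dist_eq, abs_le]
      have h1 : ((min (φ z) n : ℝ≥0) : ℝ) ≤ n := by exact_mod_cast min_le_right _ _
      have h2 : ((min (φ z') n : ℝ≥0) : ℝ) ≤ n := by exact_mod_cast min_le_right _ _
      have h3 := NNReal.coe_nonneg (min (φ z) n)
      have h4 := NNReal.coe_nonneg (min (φ z') n)
      constructor <;> simp only [ContinuousMap.coe_mk] <;> linarith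
  have ht := (ProbabilityMeasure.tendsto_iff_forall_lintegral_tendsto.1 hμ) g
  refine le_of_tendsto ht (Filter.Eventually.of_forall fun i => le_trans ?_ (hb i))
  exact lintegral_mono fun z => ENNReal.coe_le_coe.2 (min_le_left _ _)

theorem exists_invariant (hf : Continuous f) {a M : ℝ} (hfM : ∀ x, ‖f x‖ ≤ a + M * ‖x‖)
    {N : Phase d → ℝ} {C C' q : ℝ} (hN : Continuous N)
    (hN0 : ∀ z, 0 ≤ N z) (htri : ∀ z z', N z ≤ N (z - z') + N z')
    (hup : ∀ z, N z ≤ C * ‖z‖) (hC' : 0 ≤ C') (hlow : ∀ z, ‖z‖ ≤ C' * N z)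
    (hq : 0 ≤ q) (hq1 : q < 1)
    (h : ∀ z z' G, N (obaboStep f lam γ (z, G) - obaboStep f lam γ (z', G)) ≤ q * N (z - z')) :
    ∃ σ : Measure (Phase d), IsProbabilityMeasure σ ∧ (obaboKernel f lam γ).Invariant σ ∧
      ∀ p : ℝ, 1 ≤ p → ∫⁻ z, ENNReal.ofReal (N z) ^ p ∂σ < ⊤ := by
  let P := obaboKernel f lam γ
  let μ : ℕ → ProbabilityMeasure (Phase d) := fun n =>
    ⟨lawAfter P n (Measure.dirac 0), isProbabilityMeasure_lawAfter hf.measurable n _⟩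
  have hmom : ∀ p : ℝ, 1 ≤ p → ∃ b : ℝ≥0, ∀ n,
      ∫⁻ z, ENNReal.ofReal (N z) ^ p ∂(lawAfter P n (Measure.dirac 0)) ≤ b := by
    intro p hp
    have hp0 : 0 < p := by linarith
    obtain ⟨b, hb⟩ := exists_eLpNorm_lawAfter_le (lam := lam) (γ := γ) hf hfM hN hN0 htri hup hq
      hq1 h (p := ENNReal.ofReal p) (by simpa using hp) ENNReal.ofReal_ne_top
    refine ⟨b ^ p, fun n => ?_⟩
    have h1 := hb n
    rw [eLpNorm_eq_lintegral_rpow_enorm_toReal (by simpa using hp0) ENNReal.ofReal_ne_top,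
      ENNReal.toReal_ofReal hp0.le, one_div] at h1
    rw [ENNReal.coe_rpow_of_nonneg _ hp0.le, ← ENNReal.rpow_inv_le_iff hp0]
    simpa only [Real.enorm_of_nonneg (hN0 _)] using h1
  -- Markov's inequality for the uniformly bounded first moment; Prokhorov's theorem then gives
  -- compactness.
  have htight : IsTightMeasureSet {x | ∃ ρ ∈ Set.range μ, (ρ : Measure (Phase d)) = x} := by
    apply isTightMeasureSet_of_tendsto_measure_norm_gt
    obtain ⟨b, hb⟩ := hmom 1 le_rfl
    have hlim : Filter.Tendsto (fun R : ℝ => ENNReal.ofReal (C' * b / R)) Filter.atTop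
        (nhds 0) := by
      have := (tendsto_const_nhds (x := C' * (b : ℝ))).div_atTop Filter.tendsto_id
      simpa using ENNReal.tendsto_ofReal this
    refine tendsto_of_tendsto_of_tendsto_of_le_of_le' tendsto_const_nhds hlim
      (Filter.Eventually.of_forall fun _ => bot_le) ?_
    filter_upwards [Filter.eventually_gt_atTop 0] with R hR
    refine iSup₂_le fun ρ hρ => ?_
    obtain ⟨_, ⟨n, rfl⟩, rfl⟩ := hρ
    change lawAfter P n (Measure.dirac 0) _ ≤ _
    have h1 : ∫⁻ z, ENNReal.ofReal ‖z‖ ∂(lawAfter P n (Measure.dirac 0)) ≤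
        ENNReal.ofReal (C' * b) := by
      calc _ ≤ ∫⁻ z, ENNReal.ofReal C' * ENNReal.ofReal (N z) ^ (1 : ℝ)
            ∂(lawAfter P n (Measure.dirac 0)) := by
            refine lintegral_mono fun z => ?_
            rw [ENNReal.rpow_one, ← ENNReal.ofReal_mul hC']
            exact ENNReal.ofReal_le_ofReal (hlow z)
        _ = ENNReal.ofReal C' * ∫⁻ z, ENNReal.ofReal (N z) ^ (1 : ℝ)
            ∂(lawAfter P n (Measure.dirac 0)) := lintegral_const_mul' _ _ ENNReal.ofReal_ne_top
        _ ≤ ENNReal.ofReal C' * b := by gcongr; exact hb n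
        _ = ENNReal.ofReal (C' * b) := by
            rw [ENNReal.ofReal_mul hC', ENNReal.ofReal_coe_nnreal]
    calc lawAfter P n (Measure.dirac 0) {x | R < ‖x‖}
        ≤ lawAfter P n (Measure.dirac 0) {x | ENNReal.ofReal R ≤ ENNReal.ofReal ‖x‖} :=
          measure_mono fun x hx => ENNReal.ofReal_le_ofReal (le_of_lt hx)
      _ ≤ (∫⁻ z, ENNReal.ofReal ‖z‖ ∂(lawAfter P n (Measure.dirac 0))) / ENNReal.ofReal R :=
          meas_ge_le_lintegral_div (by fun_prop) (by simpa using hR) ENNReal.ofReal_ne_top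
      _ ≤ ENNReal.ofReal (C' * b) / ENNReal.ofReal R := by gcongr
      _ = ENNReal.ofReal (C' * b / R) := (ENNReal.ofReal_div_of_pos hR).symm
  have hcomp := isCompact_closure_of_isTightMeasureSet htight
  -- A limit along a nonprincipal ultrafilter plays the role of a convergent subsequence.
  let 𝒰 : Ultrafilter ℕ := Filter.hyperfilter ℕ
  obtain ⟨σ, -, hσ⟩ := hcomp.ultrafilter_le_nhds (𝒰.map μ) (by
    rw [Filter.le_principal_iff]
    exact Filter.mem_map.2 (Filter.Eventually.of_forall fun n => subset_closure ⟨n, rfl⟩))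
  have hσ' : Filter.Tendsto μ 𝒰 (nhds σ) := hσ
  have h𝒰 : (𝒰 : Filter ℕ) ≤ Filter.atTop := by
    rw [← Nat.cofinite_eq_atTop]; exact Filter.hyperfilter_le_cofinite
  refine ⟨σ, inferInstance, ?_, fun p hp => ?_⟩
  · have hint : ∀ {g : Phase d → ℝ} {B : ℝ}, Continuous g → (∀ z, |g z| ≤ B) →
        Filter.Tendsto (fun n => ∫ z, g z ∂(lawAfter P n (Measure.dirac 0))) 𝒰
          (nhds (∫ z, g z ∂(σ : Measure (Phase d)))) := fun {g B} hg hB =>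
      (ProbabilityMeasure.tendsto_iff_forall_integral_tendsto.1 hσ')
        (BoundedContinuousFunction.ofNormedAddCommGroup g hg B hB)
    have hPσ := isProbabilityMeasure_bind (lam := lam) (γ := γ) hf.measurable
      (σ : Measure (Phase d))
    have hPδ := isProbabilityMeasure_bind (lam := lam) (γ := γ) hf.measurable
      (Measure.dirac (0 : Phase d))
    refine measure_eq_of_forall_integral_lipschitz_eq fun g B K hB hg => ?_
    have hgN : ∀ z z', |g z - g z'| ≤ |K| * C' * N (z - z') := fun z z' => by
      refine (hg z z').trans ?_
      rw [mul_assoc]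
      exact mul_le_mul (le_abs_self K) (hlow _) (norm_nonneg _) (abs_nonneg _)
    have hgc := continuous_of_abs_sub_le hup (by positivity) hgN
    obtain ⟨g₁, hB₁, hg₁, hg₁int⟩ := exists_integral_lawAfter_eq (lam := lam) (γ := γ)
      hf.measurable hup hq h (by positivity) hB hgN 1
    have hone : ∀ ρ : Measure (Phase d), lawAfter P 1 ρ = ρ.bind P := fun ρ => rfl
    have hg₁c := continuous_of_abs_sub_le hup (by positivity) hg₁
    have t1 := hint hgc hB
    have t2 := hint hg₁c hB₁
    -- The chains started from the Dirac mass and from its image under `P` merge. The second is the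
    -- first shifted by one step, so its integrals of `g` are those of `g₁`, the image of `g` under
    -- the dual action. In the limit `g` and `g₁` have equal integrals under `σ`.
    have t3 := (tendsto_integral_lawAfter_sub (lam := lam) (γ := γ) hf.measurable hup hq hq1 h
      (by positivity) hB hgN ((Measure.dirac (0 : Phase d)).bind P) (Measure.dirac 0)).mono_left h𝒰
    have t4 : ∀ n, ∫ z, g z ∂(lawAfter P n ((Measure.dirac (0 : Phase d)).bind P)) =
        ∫ z, g₁ z ∂(lawAfter P n (Measure.dirac 0)) := fun n => by
      rw [← hg₁int _ (isProbabilityMeasure_lawAfter hf.measurable n _), hone, ← lawAfter_succ,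
        ← lawAfter_succ']
    have t5 := tendsto_nhds_unique t3 ((t2.sub t1).congr fun n => by rw [← t4])
    have t6 := hg₁int σ inferInstance
    rw [hone] at t6
    change ∫ z, g z ∂((σ : Measure (Phase d)).bind P) = _
    linarith
  · obtain ⟨b, hb⟩ := hmom p hp
    have hp0 : 0 ≤ p := by linarith
    have e : ∀ z, ENNReal.ofReal (N z) ^ p = ((N z).toNNReal ^ p : ℝ≥0) := fun z => by
      rw [ENNReal.coe_rpow_of_nonneg _ hp0]; rfl
    simp_rw [e] at hb ⊢
    refine lt_of_le_of_lt (lintegral_le_of_tendsto hσ'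
      (φ := fun z => (N z).toNNReal ^ p) ?_ hb) ENNReal.coe_lt_top
    exact (NNReal.continuous_rpow_const hp0).comp (continuous_real_toNNReal.comp hN)

end Existence

/-! ### The weighted norm as a norm -/

section WeightedNorm

variable {d : ℕ} {M γ : ℝ}

theorem continuous_weightedNorm (a b : ℝ) : Continuous (weightedNorm (d := d) a b) := by
  unfold weightedNorm; fun_prop

theorem weightedNorm_nonneg (a b : ℝ) (z : Phase d) : 0 ≤ weightedNorm a b z := Real.sqrt_nonneg _

/-- Completing the square, possible since `1/M ≥ 1/γ²`, writes the weighted norm as a Hilbert norm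
after a linear change of variables, which gives the triangle inequality. -/
theorem weightedNorm_eq_norm (hM : 0 < M) (hγ : 0 < γ) (hγM : 2 * √M ≤ γ) (z : Phase d) :
    weightedNorm (1 / M) (1 / γ) z =
      ‖WithLp.toLp 2 (z.1 + (1 / γ) • z.2, √(1 / M - (1 / γ) ^ 2) • z.2)‖ := by
  have h0 : 0 ≤ 1 / M - (1 / γ) ^ 2 := by
    rw [sub_nonneg, one_div_pow]
    apply one_div_le_one_div_of_le hM
    linarith [sq_le_of_two_sqrt_le hM.le hγM]
  rw [← sq_eq_sq₀ (weightedNorm_nonneg _ _ _) (norm_nonneg _), weightedNorm_sq hM hγ hγM,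
    WithLp.prod_norm_sq_eq_of_L2]
  rw [WithLp.toLp_fst, WithLp.toLp_snd, @norm_add_sq_real, norm_smul, norm_smul, real_inner_smul_right, mul_pow, mul_pow,
    Real.norm_eq_abs, Real.norm_eq_abs, sq_abs, sq_abs, Real.sq_sqrt h0]
  ring

theorem weightedNorm_le_add (hM : 0 < M) (hγ : 0 < γ) (hγM : 2 * √M ≤ γ) (z z' : Phase d) :
    weightedNorm (1 / M) (1 / γ) z ≤
      weightedNorm (1 / M) (1 / γ) (z - z') + weightedNorm (1 / M) (1 / γ) z' := by
  simp only [weightedNorm_eq_norm hM hγ hγM]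
  have e : (z.1 + (1 / γ) • z.2, √(1 / M - (1 / γ) ^ 2) • z.2) =
      ((z - z').1 + (1 / γ) • (z - z').2, √(1 / M - (1 / γ) ^ 2) • (z - z').2) +
        (z'.1 + (1 / γ) • z'.2, √(1 / M - (1 / γ) ^ 2) • z'.2) := by
    refine Prod.ext ?_ ?_
    · simp only [Prod.fst_add, Prod.fst_sub, Prod.snd_sub]; module
    · simp only [Prod.snd_add, Prod.snd_sub]; module
  rw [e, WithLp.toLp_add]
  exact norm_add_le _ _

theorem weightedNorm_le_norm (hM : 0 < M) (hγ : 0 < γ) (hγM : 2 * √M ≤ γ) (z : Phase d) :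
    weightedNorm (1 / M) (1 / γ) z ≤ √(3 / 2 * (1 + 1 / M)) * ‖z‖ := by
  apply le_of_sq_le_sq _ (by positivity)
  rw [weightedNorm_sq hM hγ hγM, mul_pow, Real.sq_sqrt (by positivity)]
  refine (quadratic_form_bounds hM hγ hγM z).2.trans ?_
  have h1 : ‖z.1‖ ^ 2 ≤ ‖z‖ ^ 2 := by gcongr; exact norm_fst_le z
  have h2 : 1 / M * ‖z.2‖ ^ 2 ≤ 1 / M * ‖z‖ ^ 2 := by gcongr; exact norm_snd_le z
  linarith

theorem euclNorm_le_mul_weightedNorm (hM : 0 < M) (hγ : 0 < γ) (hγM : 2 * √M ≤ γ) (z : Phase d) :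
    euclNorm z ≤ √(2 * (1 + M)) * weightedNorm (1 / M) (1 / γ) z := by
  apply Real.sqrt_le_iff.2 ⟨mul_nonneg (Real.sqrt_nonneg _) (weightedNorm_nonneg _ _ _), ?_⟩
  rw [mul_pow, Real.sq_sqrt (by positivity), weightedNorm_sq hM hγ hγM]
  have h1 := mul_le_mul_of_nonneg_left (quadratic_form_bounds hM hγ hγM z).1
    (by positivity : 0 ≤ 2 * (1 + M))
  have h2 : 2 * (1 + M) * ((‖z.1‖ ^ 2 + 1 / M * ‖z.2‖ ^ 2) / 2) =
      ‖z.1‖ ^ 2 + ‖z.2‖ ^ 2 + (M * ‖z.1‖ ^ 2 + 1 / M * ‖z.2‖ ^ 2) := by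
    field_simp; ring
  have h3 : 0 ≤ M * ‖z.1‖ ^ 2 + 1 / M * ‖z.2‖ ^ 2 := by positivity
  linarith

theorem norm_le_euclNorm (z : Phase d) : ‖z‖ ≤ euclNorm z := by
  refine max_le ?_ ?_ <;> refine Real.le_sqrt_of_sq_le ?_
  · exact le_add_of_nonneg_right (sq_nonneg _)
  · exact le_add_of_nonneg_left (sq_nonneg _)

end WeightedNorm

/-! ### Assembling contraction, existence and uniqueness -/

section Conclusion

variable {d : ℕ} {f : E d → E d} {m M lam γ : ℝ}

theorem wass_sq_le_of_norm_sq_le {N N' : Phase d → ℝ} (hN : ∀ z, 0 ≤ N z)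
    {p k : ℝ} (hp : 1 ≤ p) (hk : 0 < k) (h : ∀ z, N' z ^ 2 ≤ k * N z ^ 2)
    (μ ν : Measure (Phase d)) : wass N' p μ ν ^ 2 ≤ ENNReal.ofReal k * wass N p μ ν ^ 2 := by
  have h1 := wass_le_of_norm_le hp (Real.sqrt_pos.2 hk) (N := N) (N' := N') (fun z => by
    apply le_of_sq_le_sq _ (mul_nonneg (Real.sqrt_nonneg _) (hN z))
    rw [mul_pow, Real.sq_sqrt hk.le]
    exact h z) μ ν
  calc _ ≤ (ENNReal.ofReal √k * wass N p μ ν) ^ 2 := by gcongr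
    _ = _ := by rw [mul_pow, ← ENNReal.ofReal_pow (Real.sqrt_nonneg _), Real.sq_sqrt hk.le]

/-- Contraction and ergodicity of the OBABO chain for a Lipschitz drift `f` such that `f - m` is
cocoercive. -/
theorem obabo_contraction_and_ergodicity (hm : 0 < m) (hmM : m ≤ M)
    (hlam : 0 < lam) (hγ : 0 < γ) (hγM : 2 * √M ≤ γ) (hlamγ : lam ≤ m / (33 * γ ^ 3))
    (hf : ∀ x y, ‖f x - f y‖ ≤ M * ‖x - y‖)
    (hfc : ∀ x y, ‖f x - f y - m • (x - y)‖ ^ 2 ≤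
      3 * (M - m) * inner ℝ (f x - f y - m • (x - y)) (x - y)) :
    (∀ p : ℝ, 1 ≤ p → ∀ ν μ : Measure (Phase d), InPp p ν → InPp p μ →
      wass (weightedNorm (1 / M) (1 / γ)) p (ν.bind (obaboKernel f lam γ))
          (μ.bind (obaboKernel f lam γ)) ^ 2 ≤
          ENNReal.ofReal (1 - lam * (m / (3 * γ))) *
            wass (weightedNorm (1 / M) (1 / γ)) p ν μ ^ 2 ∧
      (1 ≤ M → ∀ n : ℕ,
        wass euclNorm p (lawAfter (obaboKernel f lam γ) n ν)
            (lawAfter (obaboKernel f lam γ) n μ) ^ 2 ≤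
          ENNReal.ofReal (3 * M * (1 - lam * (m / (3 * γ))) ^ n) * wass euclNorm p ν μ ^ 2)) ∧
    (∃ σ : Measure (Phase d), IsProbabilityMeasure σ ∧ (obaboKernel f lam γ).Invariant σ ∧
      (∀ p : ℝ, 1 ≤ p → InPp p σ) ∧
      ∀ σ' : Measure (Phase d), IsProbabilityMeasure σ' → (obaboKernel f lam γ).Invariant σ' →
        σ' = σ) := by
  have hM : 0 < M := hm.trans_le hmM
  have hfl : LipschitzWith M.toNNReal f := LipschitzWith.of_dist_le' fun x y => by
    simpa only [dist_eq_norm] using hf x y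
  have hfM : ∀ x, ‖f x‖ ≤ ‖f 0‖ + M * ‖x‖ := fun x => by
    have h1 := hf x 0
    rw [sub_zero] at h1
    linarith [norm_le_norm_add_norm_sub' (f x) (f 0)]
  set N : Phase d → ℝ := weightedNorm (1 / M) (1 / γ) with hN
  set c := 1 - lam * (m / (3 * γ)) with hc
  have hc1 : c < 1 := by
    have : 0 < lam * (m / (3 * γ)) := by positivity
    linarith
  -- From `m ≤ M ≤ γ² / 4` and the bound on the step, `λ κ ≤ m² / (99 γ⁴) < 1`, so `√c` is a genuine
  -- contraction factor.
  have hc0 : 0 < c := by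
    have h4 := sq_le_of_two_sqrt_le hM.le hγM
    have h1 : lam * (m / (3 * γ)) ≤ m / (33 * γ ^ 3) * (m / (3 * γ)) := by gcongr
    have h2 : m / (33 * γ ^ 3) * (m / (3 * γ)) = m ^ 2 / (99 * (γ ^ 2) ^ 2) := by
      field_simp; norm_num
    have h3 : m ^ 2 / (99 * (γ ^ 2) ^ 2) < 1 := by
      rw [div_lt_one (by positivity)]
      have h5 : m ^ 2 ≤ (γ ^ 2) ^ 2 := by gcongr; linarith
      have h6 : 0 < (γ ^ 2) ^ 2 := by positivity
      linarith
    linarith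
  have hq : 0 < √c := Real.sqrt_pos.2 hc0
  have hq1 : √c < 1 := by rwa [Real.sqrt_lt' one_pos, one_pow]
  have hN0 : ∀ z, 0 ≤ N z := weightedNorm_nonneg _ _
  have hcontr : ∀ z z' G, N (obaboStep f lam γ (z, G) - obaboStep f lam γ (z', G)) ≤
      √c * N (z - z') := by
    intro z z' G
    apply le_of_sq_le_sq _ (mul_nonneg hq.le (hN0 _))
    rw [mul_pow, Real.sq_sqrt hc0.le]
    exact weightedNorm_obaboStep_sub_le hm hmM hlam hγ hγM hlamγ hf hfc z z' G
  have hNc : Continuous N := continuous_weightedNorm _ _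
  have hlow : ∀ z, ‖z‖ ≤ √(2 * (1 + M)) * N z := fun z =>
    (norm_le_euclNorm z).trans (euclNorm_le_mul_weightedNorm hM hγ hγM z)
  have hup := weightedNorm_le_norm (d := d) hM hγ hγM
  have hiter : ∀ p : ℝ, 1 ≤ p → ∀ ν μ : Measure (Phase d), InPp p ν → ∀ n,
      wass N p (lawAfter (obaboKernel f lam γ) n ν) (lawAfter (obaboKernel f lam γ) n μ) ^ 2 ≤
        ENNReal.ofReal (c ^ n) * wass N p ν μ ^ 2 := by
    intro p hp ν μ hν n
    have := hν.1
    have h1 := wass_lawAfter_le hfl.continuous.measurable hNc.measurable hp hq hcontr ν μ n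
    calc _ ≤ (ENNReal.ofReal (√c ^ n) * wass N p ν μ) ^ 2 := by gcongr
      _ = _ := by
        rw [mul_pow, ← ENNReal.ofReal_pow (by positivity), ← pow_mul, mul_comm n 2, pow_mul,
          Real.sq_sqrt hc0.le]
  refine ⟨fun p hp ν μ hν hμ => ⟨?_, fun hM1 n => ?_⟩, ?_⟩
  · have := hiter p hp ν μ hν 1
    rwa [pow_one] at this
  · have h1 := wass_sq_le_of_norm_sq_le (N := N) (N' := euclNorm) hN0
      hp (by positivity) (euclNorm_le_weightedNorm hM1 hγ hγM)
      (lawAfter (obaboKernel f lam γ) n ν) (lawAfter (obaboKernel f lam γ) n μ)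
    have h2 := wass_sq_le_of_norm_sq_le (N := euclNorm) (N' := N) (fun z => Real.sqrt_nonneg _)
      hp (by positivity) (weightedNorm_le_euclNorm hM1 hγ hγM) ν μ
    calc _ ≤ ENNReal.ofReal (2 * M) * (ENNReal.ofReal (c ^ n) * (ENNReal.ofReal (3 / 2) *
          wass euclNorm p ν μ ^ 2)) := by
          refine h1.trans ?_
          gcongr
          refine (hiter p hp ν μ hν n).trans ?_
          gcongr
      _ = _ := by
        rw [← mul_assoc, ← mul_assoc, ← ENNReal.ofReal_mul (by positivity),
          ← ENNReal.ofReal_mul (by positivity)]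
        congr 2
        ring
  · obtain ⟨σ, hσ, hinv, hmom⟩ := exists_invariant (lam := lam) (γ := γ) hfl.continuous hfM hNc hN0
      (weightedNorm_le_add hM hγ hγM) hup (Real.sqrt_nonneg _) hlow hq.le hq1 hcontr
    refine ⟨σ, hσ, hinv, fun p hp => ⟨hσ, ?_⟩, fun σ' hσ' hinv' =>
      invariant_unique hfl.continuous.measurable hup (Real.sqrt_nonneg _) hlow hq.le hq1 hcontr
        hinv' hinv⟩
    have hp0 : 0 ≤ p := by linarith
    have hfin : ENNReal.ofReal √(2 * (1 + M)) ^ p ≠ ⊤ :=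
      ENNReal.rpow_ne_top_of_nonneg hp0 ENNReal.ofReal_ne_top
    refine lt_of_le_of_lt (lintegral_mono fun z => ofReal_rpow_le_of_le_mul (Real.sqrt_nonneg _) hp0
      (euclNorm_le_mul_weightedNorm hM hγ hγM z)) ?_
    rw [lintegral_const_mul' _ _ hfin]
    exact ENNReal.mul_lt_top hfin.lt_top (hmom p hp)

end Conclusion

end TamedOBABO

theorem mainTheorem8 (d : ℕ) (hd : 0 < d)
    (u : E d → ℝ) (hu : Differentiable ℝ u)
    (m L l : ℝ) (hm : 0 < m) (hL : 0 < L) (hl : 0 < l)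
    (hconv : StrongMonotone (gradient u) m)
    (hlip : PolyLipschitz (gradient u) L l)
    (lam γ M : ℝ) (hlam : 0 < lam) (hγ : 0 < γ)
    -- `M` is the Lipschitz constant of the tamed drift, or any upper bound of it
    (hM : (lipConst (tamedDrift (gradient u) m L l lam) : ℝ) ≤ M)
    (hγM : 2 * √M ≤ γ) (hlamγ : lam ≤ m / (33 * γ ^ 3)) :
    let P : Kernel (Phase d) (Phase d) :=
      obaboKernel (tamedDrift (gradient u) m L l lam) lam γ
    let a : ℝ := 1 / M
    let b : ℝ := 1 / γ
    let κ : ℝ := m / (3 * γ)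
    (∀ p : ℝ, 1 ≤ p → ∀ ν μ : Measure (Phase d), InPp p ν → InPp p μ →
      wass (weightedNorm a b) p (ν.bind P) (μ.bind P) ^ 2 ≤
          ENNReal.ofReal (1 - lam * κ) * wass (weightedNorm a b) p ν μ ^ 2 ∧
      (1 ≤ M → ∀ n : ℕ,
        wass euclNorm p (lawAfter P n ν) (lawAfter P n μ) ^ 2 ≤
          ENNReal.ofReal (3 * M * (1 - lam * κ) ^ n) * wass euclNorm p ν μ ^ 2)) ∧
    (∃ σ : Measure (Phase d), IsProbabilityMeasure σ ∧ P.Invariant σ ∧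
      (∀ p : ℝ, 1 ≤ p → InPp p σ) ∧
      ∀ σ' : Measure (Phase d), IsProbabilityMeasure σ' → P.Invariant σ' → σ' = σ) := by
  have hr : 0 < tamingRadius m L l lam := by unfold tamingRadius; positivity
  have hdrift : tamedDrift (gradient u) m L l lam =
      tamedDriftAt (gradient u) m (tamingRadius m L l lam) := rfl
  have hf : ∀ x y, ‖tamedDriftAt (gradient u) m (tamingRadius m L l lam) x -
      tamedDriftAt (gradient u) m (tamingRadius m L l lam) y‖ ≤ M * ‖x - y‖ := by
    intro x y
    have h1 := (lipschitzWith_lipConst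
      (exists_lipschitzWith_tamedDriftAt hlip hL hl hm hr)).dist_le_mul x y
    rw [dist_eq_norm, dist_eq_norm, ← hdrift] at h1
    exact h1.trans (by gcongr)
  -- `0 ≤ R ≤ M - m`.
  have hmM : m ≤ M := by
    linarith [tamingSup_le hd hr hf,
      tamingSup_nonneg (h := gradient u) (m := m) (r := tamingRadius m L l lam)]
  exact obabo_contraction_and_ergodicity hm hmM hlam hγ hγM hlamγ hf
    (tamedDriftAt_cocoercive hu hd hm hL hl hr hconv hlip hf)
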